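/- All structures are relational structures over a finite signature whose symbols have positive arity. A finite template is a pair $(\mathbf A,\mathbf B)$ of finite structures over the same signature such that there is a homomorphism $\mathbf A\to\mathbf B$; $A$ is the universe of $\mathbf A$. An $n$-ary polymorphism of $(\mathbf A,\mathbf B)$ is a homomorphism $f:\mathbf A^n\to\mathbf B$, where $\mathbf A^n$ is the $n$-th direct power, and $\mathrm{Pol}(\mathbf A,\mathbf B)$ is the set of all polymorphisms of arity $n\ge 1$. A polymorphism $f$ is cyclic if $f(x_1,x_2,\dots,x_n)=f(x_2,\dots,x_n,x_1)$ for all $x_1,\dots,x_n\in A$, and it is a weak near-unanimity (WNU) polymorphism if for all $x,y\in A$ the value $f(x,\dots,x,y,x,\dots,x)$ does not depend on the position of the single $y$. Theorem. Each of the following eight problems is undecidable. Given an input finite template $(\mathbf A,\mathbf B)$ with $|A|\le 3$, determine whether $\mathrm{Pol}(\mathbf A,\mathbf B)$ contains (1) a cyclic polymorphism of (i) all prime arities; (ii) some arity $n\ge 2$; (iii) all but finitely many prime arities; (iv) infinitely many prime arities; (2) a WNU polymorphism of (i) all arities $k\ge 3$; (ii) some arity $k\ge 3$; (iii) all but finitely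 many arities $k\ge 3$; (iv) infinitely many arities $k\ge 3$. -/

import Mathlib

namespace PCSP

/-- A relational structure with universe `A` over the signature whose symbols are the elements of
`σ`, the symbol `R` having arity `ar R`. -/
structure RelStructure {σ : Type*} (ar : σ → ℕ) (A : Type*) where
  rel : (R : σ) → Set (Fin (ar R) → A)

section Structures

variable {σ : Type*} {ar : σ → ℕ} {A B : Type*}

/-- Homomorphisms between similar relational structures. -/
def IsHom (SA : RelStructure ar A) (SB : RelStructure ar B) (h : A → B) : Prop :=
  ∀ (R : σ) (e : Fin (ar R) → A), e ∈ SA.rel R → h ∘ e ∈ SB.rel R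

/-- The `n`-th direct power of a relational structure. -/
def power (SA : RelStructure ar A) (n : ℕ) : RelStructure ar (Fin n → A) where
  rel R := {e | ∀ j : Fin n, (fun i => e i j) ∈ SA.rel R}

/-- The `n`-ary polymorphisms of a pair of similar structures, i.e. the `n`-ary elements of the
polymorphism minion. -/
def Pol (SA : RelStructure ar A) (SB : RelStructure ar B) (n : ℕ) :
    Set ((Fin n → A) → B) :=
  {f | IsHom (power SA n) SB f}

/-- The minor `f^π` of an `n`-ary function `f` along `π : [n] → [m]`. -/
def minor {n m : ℕ} (f : (Fin n → A) → B) (π : Fin n → Fin m) : (Fin m → A) → B :=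
  fun a => f (a ∘ π)

/-- `f` is cyclic if `f = f^π` for `π = (n, 1, 2, …, n - 1)`. -/
def IsCyclic {n : ℕ} (f : (Fin n → A) → B) : Prop :=
  f = minor f (finRotate n).symm

/-- The map `[n] → [2]` that sends `i` to the first element and all other elements to the
second one. -/
def single {n : ℕ} (i : Fin n) : Fin n → Fin 2 :=
  fun o => if o = i then 0 else 1

/-- `f` is a weak near-unanimity (WNU) function: the binary minor `f(y, …, y, x, y, …, y)` does not
depend on the position of the lone `x`. -/
def IsWNU {n : ℕ} (f : (Fin n → A) → B) : Prop :=
  ∀ i j : Fin n, minor f (single i) = minor f (single j)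

end Structures

/-- Finite descriptions of pairs of similar finite relational structures. In
`((a, b), [(k₁, L₁, M₁), …, (kₘ, Lₘ, Mₘ)])`, the numbers `a` and `b` are the sizes of the two
universes `{0, …, a - 1}` and `{0, …, b - 1}`, the signature has `m` symbols, the `i`-th symbol has
arity `kᵢ`, and it is interpreted by the relations that consist of the `kᵢ`-tuples listed in `Lᵢ`
and `Mᵢ`, respectively (listed words that are not `kᵢ`-tuples over the universe are ignored). -/
abbrev TemplateCode : Type :=
  (ℕ × ℕ) × List (ℕ × List (List ℕ) × List (List ℕ))

/-- The relation on `{0, …, n - 1}` of arity `k` whose tuples are listed in `L`. -/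
def listedRel (n k : ℕ) (L : List (List ℕ)) : Set (Fin k → Fin n) :=
  {e | List.ofFn (fun i => (e i : ℕ)) ∈ L}

namespace TemplateCode

/-- The size of the universe of the left structure. -/
def sizeA (t : TemplateCode) : ℕ := t.1.1

/-- The size of the universe of the right structure. -/
def sizeB (t : TemplateCode) : ℕ := t.1.2

/-- The arities of the symbols of the signature. -/
def arity (t : TemplateCode) (R : Fin t.2.length) : ℕ := (t.2.get R).1

/-- The left structure. -/
def left (t : TemplateCode) : RelStructure t.arity (Fin t.sizeA) where
  rel R := listedRel t.sizeA (t.arity R) (t.2.get R).2.1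

/-- The right structure. -/
def right (t : TemplateCode) : RelStructure t.arity (Fin t.sizeB) where
  rel R := listedRel t.sizeB (t.arity R) (t.2.get R).2.2

/-- `t` describes a finite template: all symbols have positive arity, and the left structure maps
homomorphically to the right one. -/
def IsTemplate (t : TemplateCode) : Prop :=
  (∀ R, 1 ≤ t.arity R) ∧ ∃ h : Fin t.sizeA → Fin t.sizeB, IsHom t.left t.right h

/-- The polymorphism minion contains a cyclic element of arity `n`. -/
def HasCyclic (t : TemplateCode) (n : ℕ) : Prop :=
  ∃ f ∈ Pol t.left t.right n, IsCyclic f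

/-- The polymorphism minion contains a WNU element of arity `n`. -/
def HasWNU (t : TemplateCode) (n : ℕ) : Prop :=
  ∃ f ∈ Pol t.left t.right n, IsWNU f

end TemplateCode

/-- The problem "given an input `x` satisfying `valid`, to determine whether `P x` holds" is
undecidable: no partial recursive function halts with the correct answer on each valid input.
Nothing is required of its behaviour on the other inputs. -/
def Undecidable {α : Type*} [Primcodable α] (valid P : α → Prop) : Prop :=
  ¬ ∃ f : α →. Bool, Partrec f ∧
    ∀ x, valid x → (P x → true ∈ f x) ∧ (¬ P x → false ∈ f x)

/-- The admissible inputs: finite templates whose left structure has at most three elements. -/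
def SmallTemplate (t : TemplateCode) : Prop :=
  t.IsTemplate ∧ t.sizeA ≤ 3

end PCSP

/-! The halting problem of one fixed Turing machine `M` is reduced to all eight problems. A word
`l`, stored in the right structure, is pushed on a blank tape before `M` runs. An `n`-ary
polymorphism labels the tuples over `{0, 1, 2}`; the tuple with `n - j` entries 0, then `j - i`
entries 1, then `i` entries 2 stands for the cell at time `j` and distance `i` from the head.
Turning one 0 into 1 is a time step, turning one 1 into 2 is a move away from the head, so
constraints on pairs of labels force the space-time diagram up to time `n` (`diagram_unique`,
`state_of_tileSpecs`). One more constraint prescribes by a bit whether `M` is halted at time `n`.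
Conversely, labels computed from the numbers of 1s and 2s satisfy the constraints
(`holds_tileSpecs`).

A relation is applied coordinatewise, so it cannot say that only one entry changes. The set of
changed coordinates is therefore passed as a further argument, and the constraint is active only if
the label of that set certifies a singleton. The certificates obey constraints of their own. These
force every cyclic (or WNU) labelling to certify the singletons (`unit_of_cyclicSpecs`,
`unit_of_wnuSpecs`), yet allow a symmetric labelling that certifies nothing else
(`certHolds_cyclicCert` for prime arity, `certHolds_wnuCert` together with `isWNU_wnuCert`).

Thus, in prime arities for cyclic polymorphisms and in arities at least 3 for WNUs, a polymorphism
of arity `n` exists exactly if being halted at time `n` agrees with the bit. Halting persists in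
time, so the bit `true` settles "some" and "infinitely many", and the bit `false` settles "all" and
"all but finitely many" (`undecidable_of_arities`). -/

namespace PCSP

open Turing

/-! ### Space-time diagrams of Turing machines -/

/-- The successor state, the symbol put under the head, and the shift of the tape, of a machine
that first pushes the symbols of a word on the tape (`w` is the next one) and then runs `M`;
the state `none` is the halted one. -/
def action {Γ Q : Type} (M : Q → Γ → Option (Q × TM0.Stmt Γ)) :
    Option Γ → Option Q → Γ → Option Q × Option Γ × SignType
  | some b, q, _ => (q, some b, -1)
  | none, none, _ => (none, none, 0)
  | none, some q, a =>
    match M q a with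
    | none => (none, none, 0)
    | some (q', TM0.Stmt.write b) => (some q', some b, 0)
    | some (q', TM0.Stmt.move Dir.left) => (some q', none, -1)
    | some (q', TM0.Stmt.move Dir.right) => (some q', none, 1)

/-- A configuration: the number of symbols pushed so far, the state, and the tape as seen from the
head. -/
structure Conf (Γ Q : Type) where
  pc : ℕ
  state : Option Q
  tape : ℤ → Γ

section Diagram

variable {Γ Q : Type} (blank : Γ) (q₀ : Q) (M : Q → Γ → Option (Q × TM0.Stmt Γ)) (l : List Γ)

/-- One step of the machine. -/
def nextConf (c : Conf Γ Q) : Conf Γ Q :=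
  let act := action M l[c.pc]? c.state (c.tape 0)
  { pc := c.pc + if l[c.pc]?.isSome then 1 else 0
    state := act.1
    tape := fun x => if x = 0 then act.2.1.getD (c.tape act.2.2) else c.tape (x + act.2.2) }

/-- The configuration at a given time, the initial tape being blank. -/
def conf : ℕ → Conf Γ Q
  | 0 => ⟨0, some q₀, fun _ => blank⟩
  | j + 1 => nextConf M l (conf j)

/-- Each step shifts the tape by at most one and writes only under the head, so a triangle of cells
contains the whole computation. -/
theorem conf_tape_blank (j : ℕ) (x : ℤ) (hx : (j : ℤ) ≤ |x|) :
    (conf blank q₀ M l j).tape x = blank := by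
  induction j generalizing x with
  | zero => rfl
  | succ j ih =>
    have hx0 : x ≠ 0 := by rintro rfl; simp at hx; omega
    simp only [conf, nextConf, if_neg hx0]
    apply ih
    push_cast at hx
    generalize (action M _ _ _).2.2 = d
    have hd : |(d : ℤ)| ≤ 1 := by cases d <;> decide
    have := abs_sub_abs_le_abs_sub x (-(d : ℤ))
    rw [sub_neg_eq_add, abs_neg] at this
    omega

theorem conf_pc_le (j : ℕ) : (conf blank q₀ M l j).pc ≤ l.length := by
  induction j with
  | zero => exact Nat.zero_le _
  | succ j ih =>
    simp only [conf, nextConf]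
    split_ifs with h
    · have := List.getElem?_eq_none_iff.not.1 (Option.ne_none_iff_isSome.2 h)
      omega
    · exact ih

/-- The contents of a cell of the space-time diagram, apart from the number of pushed symbols: the
next symbol to be pushed, the state, the symbol under the head, whether the cell is the head
cell, and the windows of the tape around the two positions at distance `i` from the head. -/
@[ext] structure Tile (Γ Q : Type) where
  next : Option Γ
  state : Option Q
  head : Γ
  atHead : Bool
  right : SignType → Γ
  left : SignType → Γ

/-- The space-time diagram. -/
def tileAt (i j : ℕ) : Tile Γ Q :=
  let c := conf blank q₀ M l j
  { next := l[c.pc]?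
    state := c.state
    head := c.tape 0
    atHead := decide (i = 0)
    right := fun s => c.tape (i + s)
    left := fun s => c.tape (-i + s) }

/-- The constraint on the cell of the head. -/
def Tile.IsEdge (r : Tile Γ Q) : Prop :=
  r.atHead = true ∧ r.right = r.left ∧ r.right 0 = r.head

/-- The constraint on the cell farthest from the head. -/
def Tile.IsDiag (r : Tile Γ Q) : Prop :=
  r.right 0 = blank ∧ r.right 1 = blank ∧ r.left 0 = blank ∧ r.left (-1) = blank

/-- The constraint on the same cell at two successive times. -/
def Tile.Step (r r' : Tile Γ Q) : Prop :=
  let act := action M r.next r.state r.head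
  r'.state = act.1 ∧
  r'.right 0 = (if r.atHead then act.2.1.getD (r.right act.2.2) else r.right act.2.2) ∧
  r'.left 0 = (if r.atHead then act.2.1.getD (r.left act.2.2) else r.left act.2.2)

/-- The constraint on two neighbouring cells at the same time. -/
def Tile.Above (r r' : Tile Γ Q) : Prop :=
  r'.state = r.state ∧ r'.head = r.head ∧ r'.atHead = false ∧
  r'.right (-1) = r.right 0 ∧ r.right 1 = r'.right 0 ∧
  r'.left 1 = r.left 0 ∧ r.left (-1) = r'.left 0

theorem isEdge_tileAt (j : ℕ) : (tileAt blank q₀ M l 0 j).IsEdge := by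
  refine ⟨by simp [tileAt], ?_, ?_⟩ <;> simp [tileAt]

theorem isDiag_tileAt (j : ℕ) : (tileAt blank q₀ M l j j).IsDiag blank := by
  refine ⟨?_, ?_, ?_, ?_⟩ <;> apply conf_tape_blank <;> simp
  · rw [abs_of_nonneg (by positivity)]; omega
  · rw [abs_of_nonpos (by omega)]; omega

theorem step_tileAt (i j : ℕ) :
    (tileAt blank q₀ M l i j).Step M (tileAt blank q₀ M l i (j + 1)) := by
  refine ⟨rfl, ?_, ?_⟩ <;> by_cases hi : i = 0 <;> simp [tileAt, conf, nextConf, hi]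

theorem above_tileAt (i j : ℕ) :
    (tileAt blank q₀ M l i j).Above (tileAt blank q₀ M l (i + 1) j) := by
  refine ⟨rfl, rfl, by simp [tileAt], ?_, ?_, ?_, ?_⟩ <;> simp [tileAt]
  ring_nf

/-- The local constraints determine a column from the contents of its cells. -/
theorem column_unique (j : ℕ) (pc : ℕ → ℕ) (r : ℕ → Tile Γ Q)
    (hvalid : ∀ i ≤ j, (r i).next = l[pc i]?)
    (hedge : (r 0).IsEdge) (hdiag : (r j).IsDiag blank)
    (habove : ∀ i < j, (r i).Above (r (i + 1)) ∧ pc (i + 1) = pc i)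
    (hpc : pc 0 = (conf blank q₀ M l j).pc) (hstate : (r 0).state = (conf blank q₀ M l j).state)
    (hright : ∀ i ≤ j, (r i).right 0 = (conf blank q₀ M l j).tape i)
    (hleft : ∀ i ≤ j, (r i).left 0 = (conf blank q₀ M l j).tape (-i)) :
    ∀ i ≤ j, pc i = (conf blank q₀ M l j).pc ∧ r i = tileAt blank q₀ M l i j := by
  -- The outer entries of the windows are read off the next cell outwards, or are blank at the last
  -- cell. The inner entries, the state and the head symbol travel outwards from the head cell, in
  -- `key`.
  have hr1 : ∀ i ≤ j, (r i).right 1 = (conf blank q₀ M l j).tape (i + 1) := by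
    intro i hi
    rcases hi.lt_or_eq with h | rfl
    · rw [(habove i h).1.2.2.2.2.1, hright _ h]; push_cast; rfl
    · rw [hdiag.2.1, conf_tape_blank]
      rw [abs_of_nonneg (by positivity)]; omega
  have hl1 : ∀ i ≤ j, (r i).left (-1) = (conf blank q₀ M l j).tape (-i - 1) := by
    intro i hi
    rcases hi.lt_or_eq with h | rfl
    · rw [(habove i h).1.2.2.2.2.2.2, hleft _ h]; push_cast; congr 1; ring
    · rw [hdiag.2.2.2, conf_tape_blank]
      rw [abs_of_nonpos (by omega)]; omega
  have key : ∀ i ≤ j, pc i = (conf blank q₀ M l j).pc ∧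
      (r i).state = (conf blank q₀ M l j).state ∧ (r i).head = (conf blank q₀ M l j).tape 0 ∧
      (r i).atHead = decide (i = 0) ∧ (r i).right (-1) = (conf blank q₀ M l j).tape (i - 1) ∧
      (r i).left 1 = (conf blank q₀ M l j).tape (-i + 1) := by
    intro i
    induction i with
    | zero =>
      intro hi
      refine ⟨hpc, hstate, ?_, by simpa using hedge.1, ?_, ?_⟩
      · rw [← hedge.2.2, hright 0 hi]; rfl
      · rw [hedge.2.1, hl1 0 hi]; simp
      · rw [← hedge.2.1, hr1 0 hi]; simp
    | succ i ih =>
      intro hi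
      obtain ⟨h1, h2, h3, h4, h5, h6⟩ := ih (by omega)
      obtain ⟨⟨a1, a2, a3, a4, a5, a6, a7⟩, hp⟩ := habove i (by omega)
      refine ⟨hp.trans h1, a1.trans h2, a2.trans h3, by simpa using a3, ?_, ?_⟩
      · rw [a4, hright i (by omega)]; push_cast; congr 1; ring
      · rw [a6, hleft i (by omega)]; push_cast; congr 1; ring
  intro i hi
  obtain ⟨h1, h2, h3, h4, h5, h6⟩ := key i hi
  refine ⟨h1, Tile.ext ?_ h2 h3 h4 ?_ ?_⟩
  · rw [hvalid i hi, h1]; rfl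
  · funext s
    rcases s with _ | _ | _
    · simpa [tileAt] using hright i hi
    · simpa [tileAt, sub_eq_add_neg] using h5
    · simpa [tileAt] using hr1 i hi
  · funext s
    rcases s with _ | _ | _
    · simpa [tileAt] using hleft i hi
    · simpa [tileAt, sub_eq_add_neg] using hl1 i hi
    · simpa [tileAt] using h6

/-- The local constraints determine the space-time diagram. -/
theorem diagram_unique (n : ℕ) (pc : ℕ → ℕ → ℕ) (r : ℕ → ℕ → Tile Γ Q)
    (hvalid : ∀ i j, i ≤ j → j ≤ n → (r i j).next = l[pc i j]?)
    (hpc : pc 0 0 = 0) (hstate : (r 0 0).state = some q₀)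
    (hedge : ∀ j ≤ n, (r 0 j).IsEdge) (hdiag : ∀ j ≤ n, (r j j).IsDiag blank)
    (hstep : ∀ i j, i ≤ j → j + 1 ≤ n → (r i j).Step M (r i (j + 1)) ∧
      pc i (j + 1) = pc i j + if (r i j).next.isSome then 1 else 0)
    (habove : ∀ i j, i + 1 ≤ j → j ≤ n →
      (r i j).Above (r (i + 1) j) ∧ pc (i + 1) j = pc i j) :
    ∀ j ≤ n, ∀ i ≤ j, pc i j = (conf blank q₀ M l j).pc ∧ r i j = tileAt blank q₀ M l i j := by
  intro j
  induction j with
  | zero =>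
    intro hj
    apply column_unique blank q₀ M l 0 (fun i => pc i 0) (fun i => r i 0)
      (fun i hi => hvalid i 0 hi hj) (hedge 0 hj) (hdiag 0 hj) (fun i hi => absurd hi (by omega))
      hpc hstate
    · intro i hi
      obtain rfl : i = 0 := by omega
      exact (hdiag 0 hj).1
    · intro i hi
      obtain rfl : i = 0 := by omega
      exact (hdiag 0 hj).2.2.1
  | succ j ih =>
    intro hj
    have ih := ih (by omega)
    have hpc' : pc 0 (j + 1) = (conf blank q₀ M l (j + 1)).pc := by
      rw [(hstep 0 j (by omega) hj).2, (ih 0 (by omega)).1, (ih 0 (by omega)).2]; rfl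
    -- The step constraint fixes the tape at distances up to `j`; at distance `j + 1` the column has
    -- a new cell, which `IsDiag` makes blank.
    have hst : ∀ i ≤ j, (tileAt blank q₀ M l i j).Step M (r i (j + 1)) := by
      intro i hi
      rw [← (ih i hi).2]
      exact (hstep i j hi hj).1
    apply column_unique blank q₀ M l (j + 1) (fun i => pc i (j + 1)) (fun i => r i (j + 1))
      (fun i hi => hvalid i _ hi hj) (hedge _ hj) (hdiag _ hj)
      (fun i hi => habove i _ (by omega) hj) hpc' (hst 0 (by omega)).1
    · intro i hi
      rcases hi.lt_or_eq with h | rfl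
      · rw [(hst i (by omega)).2.1, ← (step_tileAt blank q₀ M l i j).2.1]
        simp [tileAt]
      · rw [(hdiag _ hj).1, conf_tape_blank]
        rw [Nat.abs_cast]
    · intro i hi
      rcases hi.lt_or_eq with h | rfl
      · rw [(hst i (by omega)).2.2, ← (step_tileAt blank q₀ M l i j).2.2]
        simp [tileAt]
      · rw [(hdiag _ hj).2.2.1, conf_tape_blank]
        rw [abs_neg, Nat.abs_cast]

end Diagram

/-! ### Quaternary constraints on labelled tuples -/

/-- A quadruple of rows of a constraint, i.e. a tuple of a quaternary relation on `{0, 1, 2}`. -/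
abbrev Row : Type := Fin 3 × Fin 3 × Fin 3 × Fin 3

/-- The tuples `(u, u, u, u)` for `u` in a list. -/
def diagRows (us : List (Fin 3)) : List Row := us.map fun u => (u, u, u, u)

/-- What a constraint sees of four labels, a label being a number and an element of `R`: the four
elements of `R`, some comparisons of the numbers, and the entry of the word `l` at the first
number. -/
abbrev View (Γ R : Type) : Type := (R × R × R × R) × (Bool × Bool × Bool) × Option Γ

/-- The view of four labels. -/
def view {Γ R : Type} (l : List Γ) (x₀ x₁ x₂ x₃ : ℕ × R) : View Γ R :=
  ((x₀.2, x₁.2, x₂.2, x₃.2),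
    (decide (x₀.1 = 0), decide (x₂.1 = x₁.1), decide (x₂.1 = x₁.1 + 1)), l[x₀.1]?)

/-- A symbol of a template with quaternary relations: its left relation is listed, and its right
relation consists of the quadruples of labels whose view has a given property. -/
structure Spec (Γ R : Type) where
  rows : List Row
  rel : View Γ R → Prop

/-- `F` maps the tuples that are related coordinatewise to related labels. -/
def Spec.Holds {Γ R : Type} (s : Spec Γ R) (l : List Γ) {n : ℕ} (F : (Fin n → Fin 3) → ℕ × R) :
    Prop :=
  ∀ π₀ π₁ π₂ π₃ : Fin n → Fin 3, (∀ x, (π₀ x, π₁ x, π₂ x, π₃ x) ∈ s.rows) →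
    s.rel (view l (F π₀) (F π₁) (F π₂) (F π₃))

/-- The number of coordinates at which a tuple has the value `u`. -/
def cnt {n : ℕ} (π : Fin n → Fin 3) (u : Fin 3) : ℕ := ∑ x, if π x = u then 1 else 0

theorem cnt_comp_equiv {n : ℕ} (π : Fin n → Fin 3) (σ : Fin n ≃ Fin n) (u : Fin 3) :
    cnt (π ∘ σ) u = cnt π u :=
  Equiv.sum_comp σ fun x => if π x = u then 1 else 0

theorem cnt_congr {n : ℕ} {π ρ : Fin n → Fin 3} {u v : Fin 3} (h : ∀ x, π x = u ↔ ρ x = v) :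
    cnt π u = cnt ρ v := by
  simp only [cnt, h]

theorem cnt_eq_add {n : ℕ} {π ρ τ : Fin n → Fin 3} {u v w : Fin 3}
    (h : ∀ x, π x = u ∧ ρ x = v ∧ τ x ≠ w ∨ π x = u ∧ ρ x ≠ v ∧ τ x = w ∨
      π x ≠ u ∧ ρ x ≠ v ∧ τ x ≠ w) : cnt π u = cnt ρ v + cnt τ w := by
  rw [cnt, cnt, cnt, ← Finset.sum_add_distrib]
  refine Finset.sum_congr rfl fun x _ => ?_
  rcases h x with ⟨h1, h2, h3⟩ | ⟨h1, h2, h3⟩ | ⟨h1, h2, h3⟩ <;> simp [h1, h2, h3]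

theorem cnt_eq_zero {n : ℕ} {π : Fin n → Fin 3} {u : Fin 3} (h : ∀ x, π x ≠ u) : cnt π u = 0 := by
  simp [cnt, h]

theorem cnt_add_cnt_eq {n : ℕ} {π : Fin n → Fin 3} {u v : Fin 3} (huv : u ≠ v)
    (h : ∀ x, π x = u ∨ π x = v) : cnt π u + cnt π v = n := by
  rw [cnt, cnt, ← Finset.sum_add_distrib]
  trans ∑ _x : Fin n, 1
  · refine Finset.sum_congr rfl fun x _ => ?_
    rcases h x with h | h <;> simp [h, huv, huv.symm]
  · simp

/-- The tuple with the value `1` at `i` and `0` elsewhere. -/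
def unitTuple {n : ℕ} (i : Fin n) : Fin n → Fin 3 := fun x => if x = i then 1 else 0

/-! ### The constraints of a space-time diagram -/

section TileSpecs

variable {Γ Q C : Type} (isUnit : C → Prop) (blank : Γ) (q₀ : Q)
  (M : Q → Γ → Option (Q × TM0.Stmt Γ)) (halted : Bool)

/-- The rows that express that a coordinate marked by the first entry is changed from `u` to `v` in
the second one. -/
def changeRows (u v : Fin 3) : List Row := [(1, u, v, v), (0, 0, 0, 0), (0, 1, 1, 1), (0, 2, 2, 2)]

/-- The constraints which force the labels of tuples to be the cells of the space-time diagram; the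
last configuration has to be halted or not, as prescribed. A label has a certificate in `C` which
tells whether the tuple is a unit tuple. -/
def tileSpecs : List (Spec Γ (C × Tile Γ Q)) :=
  [⟨diagRows [0, 1, 2], fun v => v.1.1.2.next = v.2.2⟩,
   ⟨diagRows [0], fun v => v.2.1.1 = true ∧ v.1.1.2.state = some q₀⟩,
   ⟨diagRows [0, 1], fun v => v.1.1.2.IsEdge⟩,
   ⟨diagRows [0, 2], fun v => v.1.1.2.IsDiag blank⟩,
   ⟨diagRows [1, 2], fun v => v.1.1.2.state = none ↔ halted = true⟩,
   ⟨changeRows 0 1, fun v => isUnit v.1.1.1 → v.1.2.1.2.Step M v.1.2.2.1.2 ∧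
      if v.1.2.1.2.next.isSome then v.2.1.2.2 = true else v.2.1.2.1 = true⟩,
   ⟨changeRows 1 2, fun v => isUnit v.1.1.1 → v.1.2.1.2.Above v.1.2.2.1.2 ∧
      v.2.1.2.1 = true⟩]

variable (l : List Γ)

/-- The ordered tuple with `n - j` values `0`, `j - i` values `1` and `i` values `2`. -/
def orderedTuple (n i j : ℕ) : Fin n → Fin 3 :=
  fun x => if x.val < n - j then 0 else if x.val < n - i then 1 else 2

/-- Soundness: restricted to the ordered tuples, the labels satisfy the hypotheses of
`diagram_unique`. The constant tuple 1 is the head cell at time `n`, where the halting constraint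
applies. -/
theorem state_of_tileSpecs {n : ℕ} (F : (Fin n → Fin 3) → ℕ × (C × Tile Γ Q))
    (hF : ∀ s ∈ tileSpecs isUnit blank q₀ M halted, s.Holds l F)
    (hunit : ∀ i, isUnit (F (unitTuple i)).2.1) :
    (conf blank q₀ M l n).state = none ↔ halted = true := by
  simp only [tileSpecs, List.forall_mem_cons, List.not_mem_nil, false_imp_iff, implies_true,
    and_true] at hF
  obtain ⟨h1, h2, h3, h4, h5, h6, h7⟩ := hF
  have hun : ∀ us : List (Fin 3), ∀ π : Fin n → Fin 3, (∀ x, π x ∈ us) →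
      ∀ x, (π x, π x, π x, π x) ∈ diagRows us := fun us π h x =>
    List.mem_map.2 ⟨π x, h x, rfl⟩
  have key := diagram_unique blank q₀ M l n (fun i j => (F (orderedTuple n i j)).1)
    (fun i j => (F (orderedTuple n i j)).2.2) ?_ ?_ ?_ ?_ ?_ ?_ ?_ n le_rfl 0 (Nat.zero_le n)
  · have h := h5 (orderedTuple n 0 n) _ _ _ (hun _ _ fun x => by simp [orderedTuple])
    simp only [view] at h
    rw [key.2] at h
    exact h
  · intro i j hij hj
    exact h1 (orderedTuple n i j) _ _ _ (hun _ _ fun x => by simp only [orderedTuple]; grind)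
  · have := (h2 (orderedTuple n 0 0) _ _ _ (hun _ _ fun x => by simp [orderedTuple])).1
    simpa [view] using this
  · exact (h2 (orderedTuple n 0 0) _ _ _ (hun _ _ fun x => by simp [orderedTuple])).2
  · intro j hj
    exact h3 (orderedTuple n 0 j) _ _ _ (hun _ _ fun x => by simp [orderedTuple]; grind)
  · intro j hj
    exact h4 (orderedTuple n j j) _ _ _ (hun _ _ fun x => by simp [orderedTuple]; grind)
  · intro i j hij hj
    -- The coordinate `n - (j + 1)` carries the last 0 at time `j`; it is the only one to change.
    have h := h6 (unitTuple ⟨n - (j + 1), by omega⟩) (orderedTuple n i j)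
      (orderedTuple n i (j + 1)) (orderedTuple n i (j + 1)) ?_ (hunit _)
    · refine ⟨h.1, ?_⟩
      have h' := h.2
      simp only [view] at h'
      by_cases hw : (F (orderedTuple n i j)).2.2.next.isSome = true <;> simpa [hw] using h'
    · intro x
      simp only [unitTuple, orderedTuple, changeRows, Fin.ext_iff]
      rcases lt_trichotomy x.val (n - (j + 1)) with h | h | h
      · simp [h.ne, h, show x.val < n - j by omega]
      · simp [h, show n - (j + 1) < n - j by omega, show n - (j + 1) < n - i by omega]
      · simp only [h.ne', if_neg (show ¬ x.val < n - j by omega), if_false,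
          if_neg (show ¬ x.val < n - (j + 1) by omega)]
        split_ifs <;> simp
  · intro i j hij hj
    -- Here the last 1 becomes a 2.
    have h := h7 (unitTuple ⟨n - (i + 1), by omega⟩) (orderedTuple n i j)
      (orderedTuple n (i + 1) j) (orderedTuple n (i + 1) j) ?_ (hunit _)
    · refine ⟨h.1, ?_⟩
      simpa [view] using h.2
    · intro x
      simp only [unitTuple, orderedTuple, changeRows, Fin.ext_iff]
      rcases lt_trichotomy x.val (n - (i + 1)) with h | h | h
      · simp only [h.ne, if_false, if_pos h, if_pos (show x.val < n - i by omega)]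
        split_ifs <;> simp
      · simp [h, show ¬ n - (i + 1) < n - j by omega, show n - (i + 1) < n - i by omega]
      · simp [h.ne', show ¬ x.val < n - j by omega, show ¬ x.val < n - i by omega,
          show ¬ x.val < n - (i + 1) by omega]

/-- The labelling by the cells of the space-time diagram, and by given certificates. -/
def diagramLabel {n : ℕ} (cert : (Fin n → Fin 3) → C) (π : Fin n → Fin 3) :
    ℕ × (C × Tile Γ Q) :=
  ((conf blank q₀ M l (cnt π 1 + cnt π 2)).pc,
    (cert π, tileAt blank q₀ M l (cnt π 2) (cnt π 1 + cnt π 2)))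

theorem mem_diagRows {u₀ u₁ u₂ u₃ : Fin 3} {us : List (Fin 3)}
    (h : (u₀, u₁, u₂, u₃) ∈ diagRows us) : u₀ ∈ us := by
  simp only [diagRows, List.mem_map, Prod.mk.injEq] at h
  obtain ⟨u, hu, rfl, -⟩ := h
  exact hu

theorem mem_changeRows {u v u₀ u₁ u₂ u₃ : Fin 3} (h : (u₀, u₁, u₂, u₃) ∈ changeRows u v) :
    u₀ = 1 ∧ u₁ = u ∧ u₂ = v ∨ u₀ = 0 ∧ u₁ = u₂ := by
  simp only [changeRows, List.mem_cons, Prod.mk.injEq, List.not_mem_nil, or_false] at h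
  rcases h with ⟨h1, h2, h3, -⟩ | ⟨h1, h2, h3, -⟩ | ⟨h1, h2, h3, -⟩ | ⟨h1, h2, h3, -⟩ <;>
    simp_all

/-- Completeness: only certified sets trigger a step constraint, and these are singletons, so the
change shifts the counts of 0, 1 and 2 by exactly one, to a neighbouring cell of the true diagram.
-/
theorem holds_tileSpecs {n : ℕ} (cert : (Fin n → Fin 3) → C)
    (hunit : ∀ ε, isUnit (cert ε) → cnt ε 1 = 1)
    (hstate : (conf blank q₀ M l n).state = none ↔ halted = true) :
    ∀ s ∈ tileSpecs isUnit blank q₀ M halted, s.Holds l (diagramLabel blank q₀ M l cert) := by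
  simp only [tileSpecs, List.forall_mem_cons, List.not_mem_nil, false_imp_iff, implies_true,
    and_true]
  refine ⟨?_, ?_, ?_, ?_, ?_, ?_, ?_⟩ <;> intro π₀ π₁ π₂ π₃ h
  · rfl
  · have h' := fun x => mem_diagRows (h x)
    have e1 : cnt π₀ 1 = 0 := cnt_eq_zero fun x => by have := h' x; simp_all
    have e2 : cnt π₀ 2 = 0 := cnt_eq_zero fun x => by have := h' x; simp_all
    simp [view, diagramLabel, e1, e2, tileAt, conf]
  · have h' := fun x => mem_diagRows (h x)
    have e2 : cnt π₀ 2 = 0 := cnt_eq_zero fun x => by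
      have := h' x
      revert this
      generalize π₀ x = y
      revert y
      decide
    simpa [view, diagramLabel, e2] using isEdge_tileAt blank q₀ M l _
  · have h' := fun x => mem_diagRows (h x)
    have e1 : cnt π₀ 1 = 0 := cnt_eq_zero fun x => by
      have := h' x
      revert this
      generalize π₀ x = y
      revert y
      decide
    simpa [view, diagramLabel, e1] using isDiag_tileAt blank q₀ M l _
  · have h' := fun x => mem_diagRows (h x)
    have e : cnt π₀ 1 + cnt π₀ 2 = n := cnt_add_cnt_eq (by decide) fun x => by simpa using h' x
    simpa [view, diagramLabel, e, tileAt] using hstate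
  · intro hu
    have h1 := hunit _ hu
    have h' := fun x => mem_changeRows (h x)
    have e1 : cnt π₂ 1 = cnt π₁ 1 + cnt π₀ 1 := cnt_eq_add fun x => by
      rcases h' x with ⟨a, b, c⟩ | ⟨a, b⟩ <;> simp [*]
      tauto
    have e2 : cnt π₂ 2 = cnt π₁ 2 := cnt_congr fun x => by
      rcases h' x with ⟨a, b, c⟩ | ⟨a, b⟩ <;> simp [*]
    have e3 : cnt π₂ 1 + cnt π₂ 2 = cnt π₁ 1 + cnt π₁ 2 + 1 := by omega
    refine ⟨?_, ?_⟩
    · simp only [view, diagramLabel, e3]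
      rw [e2]
      exact step_tileAt blank q₀ M l _ _
    · simp only [view, diagramLabel, e3]
      simp only [tileAt, conf, nextConf]
      split_ifs <;> simp
  · intro hu
    have h1 := hunit _ hu
    have h' := fun x => mem_changeRows (h x)
    have e1 : cnt π₁ 1 = cnt π₂ 1 + cnt π₀ 1 := cnt_eq_add fun x => by
      rcases h' x with ⟨a, b, c⟩ | ⟨a, b⟩ <;> simp [*]
      tauto
    have e2 : cnt π₂ 2 = cnt π₁ 2 + cnt π₀ 1 := cnt_eq_add fun x => by
      rcases h' x with ⟨a, b, c⟩ | ⟨a, b⟩ <;> simp [*]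
      tauto
    have e3 : cnt π₂ 1 + cnt π₂ 2 = cnt π₁ 1 + cnt π₁ 2 := by omega
    refine ⟨?_, ?_⟩
    · simp only [view, diagramLabel, e3]
      rw [e2, h1]
      exact above_tileAt blank q₀ M l _ _
    · simp [view, diagramLabel, e3]

/-- Without unit tuples, there is a labelling in arity one. -/
theorem exists_holds_tileSpecs_one (cert : (Fin 1 → Fin 3) → C)
    (hunit : ∀ ε, ¬ isUnit (cert ε)) :
    ∃ g : (Fin 1 → Fin 3) → ℕ × Tile Γ Q, (∀ π, (g π).1 ≤ l.length) ∧
      ∀ s ∈ tileSpecs isUnit blank q₀ M halted, s.Holds l fun π => ((g π).1, (cert π, (g π).2)) := by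
  -- The second label is fictitious: the counter `l.length` makes its next symbol `none`, the blank
  -- windows satisfy `IsEdge` and `IsDiag`, and its state is the one prescribed. No step has to link
  -- it to the initial cell.
  refine ⟨fun π => if π 0 = 0 then (0, tileAt blank q₀ M l 0 0) else
    (l.length, ⟨none, if halted then none else some q₀, blank, true, fun _ => blank,
      fun _ => blank⟩), fun π => ?_, ?_⟩
  · dsimp only
    split_ifs <;> simp
  simp only [tileSpecs, List.forall_mem_cons, List.not_mem_nil, false_imp_iff, implies_true,
    and_true]
  refine ⟨?_, ?_, ?_, ?_, ?_, ?_, ?_⟩ <;> intro π₀ π₁ π₂ π₃ h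
  · by_cases h0 : π₀ 0 = 0 <;> simp [view, h0, tileAt, conf]
  · have h0 : π₀ 0 = 0 := by simpa using mem_diagRows (h 0)
    simp [view, h0, tileAt, conf]
  · by_cases h0 : π₀ 0 = 0
    · simpa [view, h0] using isEdge_tileAt blank q₀ M l 0
    · simp [view, h0, Tile.IsEdge]
  · by_cases h0 : π₀ 0 = 0
    · simpa [view, h0] using isDiag_tileAt blank q₀ M l 0
    · simp [view, h0, Tile.IsDiag]
  · have h0 : π₀ 0 ≠ 0 := by
      have := mem_diagRows (h 0)
      intro h0
      simp [h0] at this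
    simp [view, h0]
  · exact fun hu => absurd hu (hunit _)
  · exact fun hu => absurd hu (hunit _)

end TileSpecs

/-! ### Certificates of unit tuples -/

/-- Finitely many constraints on labels by elements of `C`. -/
abbrev CertSpecs (C : Type) : Type := List (List Row × (C × C × C × C → Prop))

/-- `cert` satisfies the constraints. -/
def CertHolds {C : Type} (S : CertSpecs C) {n : ℕ} (cert : (Fin n → Fin 3) → C) : Prop :=
  ∀ s ∈ S, ∀ π₀ π₁ π₂ π₃ : Fin n → Fin 3, (∀ x, (π₀ x, π₁ x, π₂ x, π₃ x) ∈ s.1) →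
    s.2 (cert π₀, cert π₁, cert π₂, cert π₃)

/-- The labels that certify unit tuples for cyclic functions: whether a tuple has a single `1`,
whether it has at most as many values `1` as values `2`, and whether the number of the former
divides that of the latter. -/
abbrev CyclicCert : Type := Bool × Bool × Bool

/-- The constraints for `CyclicCert`. -/
def cyclicSpecs : CertSpecs CyclicCert :=
  [([(0, 0, 0, 0), (1, 2, 2, 2), (2, 1, 1, 1)], fun c =>
      (c.1.2.1 = true ∨ c.2.1.2.1 = true) ∧
      (c.1.2.1 = true → c.2.1.2.1 = true → c.1.2.2 = true)),
   ([(0, 0, 0, 0), (1, 0, 1, 1), (2, 1, 0, 0), (0, 2, 2, 2)], fun c =>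
      c.1.2.1 = true → c.2.1.2.1 = true → c.2.2.1.2.1 = true),
   ([(0, 0, 0, 0), (1, 0, 1, 1), (2, 1, 2, 2), (0, 2, 2, 2)], fun c =>
      c.1.2.2 = true → c.2.1.2.2 = true → c.2.2.1.2.2 = true),
   ([(1, 1, 2, 1), (2, 2, 1, 0), (2, 0, 0, 0)], fun c =>
      c.1.2.2 = true → c.2.1.2.1 = true → c.2.2.1.2.1 = true → c.2.2.2.1 = true)]

/-- The intended certificates for cyclic functions of prime arity. -/
def cyclicCert {n : ℕ} (π : Fin n → Fin 3) : CyclicCert :=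
  (decide (cnt π 1 = 1 ∧ 2 ≤ n), decide (cnt π 1 ≤ cnt π 2), decide (cnt π 1 ∣ cnt π 2))

/-- For sizes `a`, `b`, `c` of disjoint sets the four constraints read: `≤` is total, and `a ≤ b ≤
a` gives `a ∣ b`; `≤` is transitive; `a ∣ b` and `b ∣ c` give `a ∣ b + c`; a set whose size divides
that of its complement and equals that of some disjoint set is a singleton. Only the last one needs
primality. -/
theorem certHolds_cyclicCert {n : ℕ} (hn : n = 1 ∨ n.Prime) :
    CertHolds cyclicSpecs (cyclicCert (n := n)) := by
  simp only [CertHolds, cyclicSpecs, List.forall_mem_cons, List.not_mem_nil, false_imp_iff,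
    implies_true, and_true]
  simp only [List.mem_cons, List.not_mem_nil, Prod.mk.injEq, or_false, cyclicCert,
    decide_eq_true_eq]
  refine ⟨?_, ?_, ?_, ?_⟩ <;> intro π₀ π₁ π₂ π₃ h
  · have e1 : cnt π₀ 1 = cnt π₁ 2 := cnt_congr fun x => by
      rcases h x with h | h | h <;> simp [h]
    have e2 : cnt π₀ 2 = cnt π₁ 1 := cnt_congr fun x => by
      rcases h x with h | h | h <;> simp [h]
    rw [e1, e2]
    exact ⟨le_total _ _, fun h1 h2 => by rw [le_antisymm h1 h2]⟩
  · have e1 : cnt π₀ 1 = cnt π₂ 1 := cnt_congr fun x => by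
      rcases h x with h | h | h | h <;> simp [h]
    have e2 : cnt π₀ 2 = cnt π₁ 1 := cnt_congr fun x => by
      rcases h x with h | h | h | h <;> simp [h]
    have e3 : cnt π₁ 2 = cnt π₂ 2 := cnt_congr fun x => by
      rcases h x with h | h | h | h <;> simp [h]
    omega
  · have e1 : cnt π₀ 1 = cnt π₂ 1 := cnt_congr fun x => by
      rcases h x with h | h | h | h <;> simp [h]
    have e2 : cnt π₀ 2 = cnt π₁ 1 := cnt_congr fun x => by
      rcases h x with h | h | h | h <;> simp [h]
    have e3 : cnt π₂ 2 = cnt π₀ 2 + cnt π₁ 2 := cnt_eq_add fun x => by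
      rcases h x with h | h | h | h <;> simp [h]
    rw [e3, ← e1]
    intro h1 h2
    exact dvd_add h1 (h1.trans (e2 ▸ h2))
  · have e1 : cnt π₀ 1 = cnt π₁ 1 := cnt_congr fun x => by
      rcases h x with h | h | h <;> simp [h]
    have e2 : cnt π₁ 2 = cnt π₂ 1 := cnt_congr fun x => by
      rcases h x with h | h | h <;> simp [h]
    have e3 : cnt π₁ 1 = cnt π₂ 2 := cnt_congr fun x => by
      rcases h x with h | h | h <;> simp [h]
    have e4 : cnt π₁ 1 = cnt π₃ 1 := cnt_congr fun x => by
      rcases h x with h | h | h <;> simp [h]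
    have e5 : cnt π₀ 2 = cnt π₁ 2 + cnt (fun x => if π₁ x = 0 then 1 else 0) 1 :=
      cnt_eq_add fun x => by rcases h x with h | h | h <;> simp [h]
    have e6 : cnt π₀ 1 + cnt π₀ 2 = n := cnt_add_cnt_eq (by decide) fun x => by
      rcases h x with h | h | h <;> simp [h]
    intro h1 h2 h3
    -- The size divides `n`, and it is not `n` because a disjoint set of the same size exists. For
    -- `n = 1` this is already contradictory.
    have hd : cnt π₀ 1 ∣ n := by
      have := dvd_add (dvd_refl (cnt π₀ 1)) h1
      rwa [e6] at this
    have hne : cnt π₀ 1 ≠ 0 := by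
      intro h0
      rw [h0, zero_dvd_iff] at hd
      rcases hn with hn | hn
      · omega
      · exact hn.ne_zero hd
    rcases hn with hn | hn
    · omega
    · rcases (Nat.dvd_prime hn).1 hd with h | h
      · exact ⟨by omega, hn.two_le⟩
      · omega

/-! ### Cyclic labellings certify the unit tuples -/

theorem isCyclic_iff {A B : Type*} {n : ℕ} {f : (Fin n → A) → B} :
    IsCyclic f ↔ ∀ π, f (π ∘ (finRotate n).symm) = f π := by
  simp only [IsCyclic, funext_iff, minor, eq_comm]

theorem cyclicCert_perm {n : ℕ} (π : Fin n → Fin 3) (σ : Fin n ≃ Fin n) :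
    cyclicCert (π ∘ σ) = cyclicCert π := by
  simp only [cyclicCert, cnt_comp_equiv]

/-- The tuple with values `1` at `i`, `2` at `j`, and `0` elsewhere. -/
def pairTuple {n : ℕ} (i j : Fin n) : Fin n → Fin 3 :=
  fun x => if x = i then 1 else if x = j then 2 else 0

/-- The tuple `(1, 2, …, 2, 0, …, 0)` with `k` values `2`. -/
def arcTuple {n : ℕ} (k : ℕ) : Fin n → Fin 3 :=
  fun x => if x.val = 0 then 1 else if x.val ≤ k then 2 else 0

open Fin.CommRing in
/-- A total transitive relation on a cycle that is invariant under rotation relates any two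
successive points in both directions. -/
theorem rel_of_rotation_invariant {m : ℕ} {r : Fin (m + 2) → Fin (m + 2) → Prop}
    (hrot : ∀ i j, r (i + 1) (j + 1) ↔ r i j) (htot : r 0 1 ∨ r 1 0)
    (htrans : ∀ i j k, i ≠ j → j ≠ k → i ≠ k → r i j → r j k → r i k) : r 0 1 ∧ r 1 0 := by
  have hsucc : ∀ k : ℕ, (r (k : Fin (m + 2)) ((k + 1 : ℕ) : Fin (m + 2)) ↔ r 0 1) ∧
      (r ((k + 1 : ℕ) : Fin (m + 2)) (k : Fin (m + 2)) ↔ r 1 0) := by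
    intro k
    induction k with
    | zero => simp
    | succ k ih =>
      rw [← ih.1, ← ih.2, Nat.cast_succ (k + 1), Nat.cast_succ k, hrot, hrot]
      exact ⟨Iff.rfl, Iff.rfl⟩
  have hne : ∀ a b : ℕ, a < m + 2 → b < m + 2 → a ≠ b → (a : Fin (m + 2)) ≠ (b : Fin (m + 2)) := by
    intro a b ha hb hab h
    rw [Fin.ext_iff, Fin.val_natCast, Fin.val_natCast, Nat.mod_eq_of_lt ha, Nat.mod_eq_of_lt hb]
      at h
    exact hab h
  have hlast : ((m + 1 : ℕ) : Fin (m + 2)) + 1 = 0 := by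
    rw [← Nat.cast_succ]; simp
  rcases htot with h | h
  · refine ⟨h, ?_⟩
    -- Follow the cycle from `0` to its last point `m + 1`; one more rotation turns `r 0 (m + 1)`
    -- into `r 1 0`.
    have : ∀ k : ℕ, k + 1 < m + 2 → r 0 ((k + 1 : ℕ) : Fin (m + 2)) := by
      intro k
      induction k with
      | zero => intro _; simpa using h
      | succ k ih =>
        intro hk
        refine htrans _ ((k + 1 : ℕ) : Fin (m + 2)) _ ?_ ?_ ?_ (ih (by omega)) ((hsucc _).1.2 h)
        · simpa using hne 0 (k + 1) (by omega) (by omega) (by omega)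
        · exact hne _ _ (by omega) (by omega) (by omega)
        · simpa using hne 0 (k + 1 + 1) (by omega) (by omega) (by omega)
    have h' := this m (by omega)
    rwa [← hrot, hlast, zero_add] at h'
  · refine ⟨?_, h⟩
    have : ∀ k : ℕ, k + 1 < m + 2 → r ((k + 1 : ℕ) : Fin (m + 2)) 0 := by
      intro k
      induction k with
      | zero => intro _; simpa using h
      | succ k ih =>
        intro hk
        refine htrans _ ((k + 1 : ℕ) : Fin (m + 2)) _ ?_ ?_ ?_ ((hsucc _).2.2 h) (ih (by omega))
        · exact hne _ _ (by omega) (by omega) (by omega)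
        · simpa using hne (k + 1) 0 (by omega) (by omega) (by omega)
        · simpa using hne (k + 1 + 1) 0 (by omega) (by omega) (by omega)
    have h' := this m (by omega)
    rwa [← hrot, hlast, zero_add] at h'

-- Cyclicity makes the comparison of singletons a rotation-invariant, total and transitive relation,
-- so neighbouring singletons are of equal size as far as the certificates tell. Hence one divides
-- the other, divisibility accumulates along arcs until the arc is the whole complement, and the
-- last constraint certifies the singleton. Primality plays no role in this direction.
open Fin.CommRing in
theorem unit_of_cyclicSpecs {n : ℕ} (hn : 2 ≤ n) (cert : (Fin n → Fin 3) → CyclicCert)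
    (hcert : CertHolds cyclicSpecs cert) (hcyc : IsCyclic cert) (i : Fin n) :
    (cert (unitTuple i)).1 = true := by
  obtain ⟨m, rfl⟩ : ∃ m, n = m + 2 := ⟨n - 2, by omega⟩
  simp only [CertHolds, cyclicSpecs, List.forall_mem_cons, List.not_mem_nil, false_imp_iff,
    implies_true, and_true] at hcert
  simp only [List.mem_cons, List.not_mem_nil, Prod.mk.injEq, or_false] at hcert
  obtain ⟨h1, h2, h3, h4⟩ := hcert
  have hrot : ∀ x, (finRotate (m + 2)).symm x = x - 1 := fun x => by
    rw [Equiv.symm_apply_eq, finRotate_apply, sub_add_cancel]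
  have hshift : ∀ π ρ : Fin (m + 2) → Fin 3, (∀ x, ρ x = π (x - 1)) → cert ρ = cert π := by
    intro π ρ h
    rw [← isCyclic_iff.1 hcyc π]
    congr 1
    funext x
    simp [h, hrot]
  have hpair : ∀ i j : Fin (m + 2), cert (pairTuple (i + 1) (j + 1)) = cert (pairTuple i j) :=
    fun i j => hshift _ _ fun x => by simp only [pairTuple, sub_eq_iff_eq_add]
  have hunit : ∀ i : Fin (m + 2), cert (unitTuple (i + 1)) = cert (unitTuple i) :=
    fun i => hshift _ _ fun x => by simp only [unitTuple, sub_eq_iff_eq_add]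
  have htot : ∀ i j : Fin (m + 2), i ≠ j →
      ((cert (pairTuple i j)).2.1 = true ∨ (cert (pairTuple j i)).2.1 = true) ∧
      ((cert (pairTuple i j)).2.1 = true → (cert (pairTuple j i)).2.1 = true →
        (cert (pairTuple i j)).2.2 = true) := fun i j hij =>
    h1 (pairTuple i j) (pairTuple j i) (pairTuple j i) (pairTuple j i) fun x => by
      simp only [pairTuple]
      clear * - hij
      split_ifs <;> simp_all
  have h01 : (0 : Fin (m + 2)) ≠ 1 := by simp
  have hle : (cert (pairTuple (0 : Fin (m + 2)) 1)).2.1 = true ∧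
      (cert (pairTuple (1 : Fin (m + 2)) 0)).2.1 = true :=
    rel_of_rotation_invariant (r := fun i j => (cert (pairTuple i j)).2.1 = true)
      (fun i j => by rw [hpair]) (htot 0 1 h01).1 fun i j k hij hjk hik =>
      h2 (pairTuple i j) (pairTuple j k) (pairTuple i k) (pairTuple i k) fun x => by
        simp only [pairTuple]
        clear * - hij hjk hik
        split_ifs <;> simp_all
  have hdvd : (cert (pairTuple (0 : Fin (m + 2)) 1)).2.2 = true := (htot 0 1 h01).2 hle.1 hle.2
  have hval : ∀ x : Fin (m + 2), x = 1 ↔ x.val = 1 := fun x => by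
    rw [Fin.ext_iff, Fin.val_one]
  have hval0 : ∀ x : Fin (m + 2), x = 0 ↔ x.val = 0 := fun x => by
    rw [Fin.ext_iff, Fin.val_zero]
  have hsub : ∀ x : Fin (m + 2), (x - 1).val = if x.val = 0 then m + 1 else x.val - 1 := by
    intro x
    split_ifs with h
    · obtain rfl := (hval0 x).2 h
      simp
    · rw [Fin.val_sub_one_of_ne_zero ((hval0 x).not.2 h)]
  -- Rotating the previous arc makes it start at coordinate 1; the third constraint then joins it to
  -- the pair formed by coordinates 0 and 1.
  have harc : ∀ k : ℕ, k + 1 < m + 2 →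
      (cert (arcTuple (k + 1) : Fin (m + 2) → Fin 3)).2.2 = true := by
    intro k
    induction k with
    | zero =>
      intro _
      convert hdvd using 4
      funext x
      simp only [arcTuple, pairTuple, hval, hval0]
      clear * -
      split_ifs <;> first | rfl | omega
    | succ k ih =>
      intro hk
      refine h3 (pairTuple 0 1) (fun x => arcTuple (k + 1) (x - 1)) (arcTuple (k + 1 + 1))
        (arcTuple (k + 1 + 1)) ?_ hdvd ?_
      · intro x
        simp only [arcTuple, pairTuple, hval, hval0, hsub]
        rcases Nat.lt_trichotomy x.val 1 with h | h | h
        · simp [show x.val = 0 by omega, show ¬ m + 1 ≤ k + 1 by omega]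
        · simp [h]
        · by_cases h' : x.val ≤ k + 1 + 1
          · simp [show x.val ≠ 0 by omega, show x.val ≠ 1 by omega, show x.val - 1 ≠ 0 by omega,
              show x.val - 1 ≤ k + 1 by omega, h']
          · simp [show x.val ≠ 0 by omega, show x.val ≠ 1 by omega, show x.val - 1 ≠ 0 by omega,
              show ¬ x.val - 1 ≤ k + 1 by omega, h']
      · rw [hshift (arcTuple (k + 1)) _ fun x => rfl]
        exact ih (by omega)
  have h0 : (cert (unitTuple (0 : Fin (m + 2)))).1 = true := by
    refine h4 (arcTuple (m + 1)) (pairTuple 0 1) (pairTuple 1 0) _ ?_ (harc m (by omega)) hle.1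
      hle.2
    intro x
    simp only [arcTuple, pairTuple, unitTuple, hval, hval0]
    rcases Nat.lt_trichotomy x.val 1 with h | h | h
    · simp [show x.val = 0 by omega]
    · simp [h]
    · simp [show x.val ≠ 0 by omega, show x.val ≠ 1 by omega, show x.val ≤ m + 1 by omega]
  have hall : ∀ k : ℕ, cert (unitTuple (k : Fin (m + 2))) = cert (unitTuple 0) := by
    intro k
    induction k with
    | zero => simp
    | succ k ih => rw [Nat.cast_succ, hunit, ih]
  have := hall i.val
  rw [Fin.cast_val_eq_self] at this
  rw [this, h0]

/-- The labels that certify unit tuples for weak near-unanimity functions. They describe the set of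
coordinates with value `1`: it has one element, or all but one, or else it contains the first
coordinate, or does not. -/
inductive WNUCert : Type
  | unit | counit | inside | outside

instance : Finite WNUCert :=
  Finite.of_surjective (![.unit, .counit, .inside, .outside] : Fin 4 → WNUCert) fun c => by
    cases c
    exacts [⟨0, rfl⟩, ⟨1, rfl⟩, ⟨2, rfl⟩, ⟨3, rfl⟩]

/-- The constraints for `WNUCert`. -/
def wnuSpecs : CertSpecs WNUCert :=
  [([(0, 0, 0, 0), (1, 0, 1, 1), (0, 1, 1, 1)], fun c =>
      (c.1 = .counit ∨ c.1 = .outside → c.2.1 = .outside →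
        c.2.2.1 = .counit ∨ c.2.2.1 = .outside) ∧
      ¬ (c.1 = .inside ∧ c.2.1 = .inside) ∧ ¬ (c.1 = .counit ∧ c.2.1 = .counit)),
   (diagRows [1], fun c => c.1 = .inside)]

open Classical in
/-- The intended certificates for weak near-unanimity functions. -/
noncomputable def wnuCert {n : ℕ} (π : Fin n → Fin 3) : WNUCert :=
  if cnt π 1 = 1 ∧ 2 ≤ n then .unit
  else if cnt π 1 + 1 = n ∧ 2 ≤ n then .counit
  else if ∃ x : Fin n, x.val = 0 ∧ π x = 1 then .inside else .outside

/-- Apart from singletons and their complements, the labels are those of the principal ultrafilter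
at the first coordinate. In a disjoint union, a co-singleton joined with an `outside` set is
unchanged, since that set must be empty; two `outside` sets never add up to a singleton. -/
theorem certHolds_wnuCert {n : ℕ} (hn : n = 1 ∨ 3 ≤ n) :
    CertHolds wnuSpecs (wnuCert (n := n)) := by
  have hle : ∀ π : Fin n → Fin 3, cnt π 1 ≤ n := fun π => by
    refine (Finset.sum_le_sum (g := fun _ => 1) fun x _ => ?_).trans (by simp)
    split_ifs <;> simp
  simp only [CertHolds, wnuSpecs, List.forall_mem_cons, List.not_mem_nil, false_imp_iff,
    implies_true, and_true]
  simp only [List.mem_cons, List.not_mem_nil, Prod.mk.injEq, or_false]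
  refine ⟨?_, ?_⟩ <;> intro π₀ π₁ π₂ π₃ h
  · have e : cnt π₂ 1 = cnt π₀ 1 + cnt π₁ 1 := cnt_eq_add fun x => by
      rcases h x with h | h | h <;> simp [h]
    have hc := hle π₂
    have hex : (∃ x : Fin n, x.val = 0 ∧ π₂ x = 1) ↔
        (∃ x : Fin n, x.val = 0 ∧ π₀ x = 1) ∨ (∃ x : Fin n, x.val = 0 ∧ π₁ x = 1) := by
      rw [← exists_or]
      refine exists_congr fun x => ?_
      rcases h x with h | h | h <;> simp [h]
    have hdisj : ¬ ((∃ x : Fin n, x.val = 0 ∧ π₀ x = 1) ∧ (∃ x : Fin n, x.val = 0 ∧ π₁ x = 1)) := by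
      rintro ⟨⟨x, hx, hx'⟩, y, hy, hy'⟩
      obtain rfl : x = y := Fin.ext (hx.trans hy.symm)
      rcases h x with h | h | h <;> simp_all
    have hz : (∃ x : Fin n, x.val = 0 ∧ π₁ x = 1) → cnt π₁ 1 ≠ 0 := by
      rintro ⟨x, -, hx⟩ h0
      have := (Finset.sum_eq_zero_iff.1 h0) x (Finset.mem_univ x)
      simp [hx] at this
    have hz0 : (∃ x : Fin n, x.val = 0 ∧ π₀ x = 1) → cnt π₀ 1 ≠ 0 := by
      rintro ⟨x, -, hx⟩ h0
      have := (Finset.sum_eq_zero_iff.1 h0) x (Finset.mem_univ x)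
      simp [hx] at this
    simp only [wnuCert]
    rw [e] at hc ⊢
    generalize cnt π₀ 1 = a at *
    generalize cnt π₁ 1 = b at *
    by_cases hP : ∃ x : Fin n, x.val = 0 ∧ π₀ x = 1 <;>
      by_cases hP' : ∃ x : Fin n, x.val = 0 ∧ π₁ x = 1
    · exact absurd ⟨hP, hP'⟩ hdisj
    all_goals
      have hQ := hex
      simp only [hP, hP', or_true, true_or, or_self, iff_true, iff_false] at hQ
      have hz' := hz
      have hz0' := hz0
      simp only [hP, hP', true_imp_iff, false_imp_iff] at hz' hz0'
      simp only [hP, hP', hQ, if_true, if_false]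
      refine ⟨?_, ?_, ?_⟩
      · split_ifs <;> simp <;> omega
      · split_ifs <;> simp
      · split_ifs <;> simp
        omega
  · have h' := fun x => mem_diagRows (h x)
    have e : cnt π₀ 1 = n := by
      have := cnt_add_cnt_eq (n := n) (π := π₀) (u := 1) (v := 0) (by decide) fun x =>
        Or.inl (by simpa using h' x)
      rwa [cnt_eq_zero (u := 0) fun x => by have := h' x; simp_all, add_zero] at this
    rw [wnuCert, if_neg (by omega), if_neg (by omega), if_pos]
    exact ⟨⟨0, by omega⟩, rfl, by simpa using h' _⟩

/-- All singletons share one label. Two of them are disjoint, which excludes `inside` and `counit`.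
If the label were `outside`, adding the coordinates one at a time would keep every initial segment
`counit` or `outside`, although the full set is `inside`. -/
theorem unit_of_wnuSpecs {n : ℕ} (hn : 2 ≤ n) (cert : (Fin n → Fin 3) → WNUCert)
    (hcert : CertHolds wnuSpecs cert)
    (hwnu : ∀ i j : Fin n, cert (unitTuple i) = cert (unitTuple j)) (i : Fin n) :
    cert (unitTuple i) = .unit := by
  simp only [CertHolds, wnuSpecs, List.forall_mem_cons, List.not_mem_nil, false_imp_iff,
    implies_true, and_true] at hcert
  simp only [List.mem_cons, List.not_mem_nil, Prod.mk.injEq, or_false] at hcert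
  obtain ⟨h1, h2⟩ := hcert
  have htop := h2 (fun _ => 1) (fun _ => 1) (fun _ => 1) (fun _ => 1) fun x => by simp [diagRows]
  have hdisj := h1 (unitTuple ⟨0, by omega⟩) (unitTuple ⟨1, by omega⟩)
    (fun x => if x.val < 2 then 1 else 0) (fun x => if x.val < 2 then 1 else 0) fun x => by
      simp only [unitTuple, Fin.ext_iff]
      rcases Nat.lt_trichotomy x.val 1 with h | h | h
      · simp [show x.val = 0 by omega]
      · simp [h]
      · simp [show x.val ≠ 0 by omega, show x.val ≠ 1 by omega, show ¬ x.val < 2 by omega]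
  rw [hwnu ⟨0, by omega⟩ i, hwnu ⟨1, by omega⟩ i] at hdisj
  rcases hv : cert (unitTuple i)
  · rfl
  · exact absurd ⟨hv, hv⟩ hdisj.2.2
  · exact absurd ⟨hv, hv⟩ hdisj.2.1
  · exfalso
    have : ∀ k : ℕ, k + 1 ≤ n → cert (fun x => if x.val < k + 1 then 1 else 0) = .counit ∨
        cert (fun x => if x.val < k + 1 then 1 else 0) = .outside := by
      intro k
      induction k with
      | zero =>
        intro _
        right
        rw [← hv, hwnu i ⟨0, by omega⟩]
        congr 1
        funext x
        simp [unitTuple, Fin.ext_iff]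
      | succ k ih =>
        intro hk
        refine (h1 _ (unitTuple ⟨k + 1, by omega⟩) _ (fun x => if x.val < k + 1 + 1 then 1 else 0)
          fun x => ?_).1 (ih (by omega)) (by rw [hwnu _ i, hv])
        simp only [unitTuple, Fin.ext_iff]
        rcases Nat.lt_trichotomy x.val (k + 1) with h | h | h
        · simp [h, h.ne, show x.val < k + 1 + 1 by omega]
        · simp [h]
        · simp [h.ne', show ¬ x.val < k + 1 by omega, show ¬ x.val < k + 1 + 1 by omega]
    have h := this (n - 1) (by omega)
    rw [show (fun x : Fin n => if x.val < n - 1 + 1 then (1 : Fin 3) else 0) = fun _ => 1 from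
      funext fun x => if_pos (by omega), htop] at h
    simp at h

/-! ### The intended labelling is a WNU -/

theorem minor_single {A B : Type*} {n : ℕ} (f : (Fin n → A) → B) (i : Fin n) (a : Fin 2 → A) :
    minor f (single i) a = f fun x => if x = i then a 0 else a 1 := by
  simp only [minor]
  congr 1
  funext x
  simp only [Function.comp, single]
  split_ifs <;> rfl

theorem unitTuple_of_isWNU {B : Type*} {n : ℕ} {f : (Fin n → Fin 3) → B} (hf : IsWNU f)
    (i j : Fin n) : f (unitTuple i) = f (unitTuple j) := by
  have := congrFun (hf i j) ![1, 0]
  rwa [minor_single, minor_single] at this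

theorem cnt_single {n : ℕ} (a : Fin 2 → Fin 3) (u : Fin 3) (i j : Fin n) :
    cnt (fun x => if x = i then a 0 else a 1) u = cnt (fun x => if x = j then a 0 else a 1) u := by
  rw [← cnt_comp_equiv (fun x => if x = j then a 0 else a 1) (Equiv.swap i j)]
  refine cnt_congr fun x => ?_
  have : Equiv.swap i j x = j ↔ x = i := by
    rw [Equiv.swap_apply_eq_iff, Equiv.swap_apply_right]
  simp only [Function.comp, this]

/-- In a tuple with one exceptional entry, the 1s form the full set, the empty set, a singleton or a
co-singleton. The asymmetric choice of the first coordinate matters for none of these. -/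
theorem isWNU_wnuCert {n : ℕ} (hn : 3 ≤ n) : IsWNU (wnuCert (n := n)) := by
  have key : ∀ (a : Fin 2 → Fin 3) (i : Fin n),
      wnuCert (fun x => if x = i then a 0 else a 1) =
        if a 0 = 1 then (if a 1 = 1 then .inside else .unit)
        else (if a 1 = 1 then .counit else .outside) := by
    intro a i
    have hc : cnt (fun x => if x = i then a 0 else a 1) 1 =
        (if a 0 = 1 then 1 else 0) + (n - 1) * (if a 1 = 1 then 1 else 0) := by
      rw [cnt, ← Finset.add_sum_erase _ _ (Finset.mem_univ i)]
      congr 1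
      · simp
      · rw [Finset.sum_congr rfl fun x hx => by rw [if_neg (Finset.ne_of_mem_erase hx)]]
        simp
    rw [wnuCert, hc]
    by_cases h0 : a 0 = 1 <;> by_cases h1 : a 1 = 1
    · simp only [h0, h1, if_true, ite_self]
      rw [if_neg (by omega), if_neg (by omega), if_pos ⟨⟨0, by omega⟩, rfl, trivial⟩]
    · simp [h0, h1]; omega
    · simp only [h0, h1, if_true, if_false]
      rw [if_neg (by omega), if_pos (by omega)]
    · simp only [h0, h1, if_false]
      rw [if_neg (by omega), if_neg (by omega), if_neg]
      rintro ⟨x, -, hx⟩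
      split_ifs at hx <;> contradiction
  intro i j
  funext a
  rw [minor_single, minor_single, key a i, key a j]

/-! ### Templates with quaternary relations -/

section Encoding

variable {Γ R : Type} {k : ℕ} (e : R ≃ Fin (k + 1))

/-- The label encoded by a number. -/
def labelOf (x : ℕ) : ℕ × R := (x / (k + 1), e.symm (Fin.ofNat (k + 1) x))

theorem labelOf_code (c : ℕ) (r : R) : labelOf e (c * (k + 1) + (e r).val) = (c, r) := by
  have h := (e r).isLt
  refine Prod.ext ?_ ?_
  · simp only [labelOf]
    rw [Nat.mul_comm, Nat.mul_add_div (Nat.succ_pos k), Nat.div_eq_of_lt h, add_zero]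
  · simp only [labelOf]
    rw [Equiv.symm_apply_eq, Fin.ext_iff]
    simp [Fin.ofNat, Nat.mul_add_mod_self_right, Nat.mod_eq_of_lt h]

/-- The words of length `m` over `{0, …, b - 1}`. -/
def wordsBelow (b : ℕ) : ℕ → List (List ℕ)
  | 0 => [[]]
  | m + 1 => (List.range b).flatMap fun x => (wordsBelow b m).map (List.cons x)

theorem mem_wordsBelow {b m : ℕ} {xs : List ℕ} :
    xs ∈ wordsBelow b m ↔ xs.length = m ∧ ∀ x ∈ xs, x < b := by
  induction m generalizing xs with
  | zero =>
    cases xs <;> simp [wordsBelow]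
  | succ m ih =>
    cases xs with
    | nil => simp [wordsBelow]
    | cons x xs => simp [wordsBelow, ih, and_left_comm]

/-- The view of the labels encoded by a list of four numbers. -/
def viewOf (l : List Γ) (xs : List ℕ) : View Γ R :=
  view l (labelOf e (xs.getD 0 0)) (labelOf e (xs.getD 1 0)) (labelOf e (xs.getD 2 0))
    (labelOf e (xs.getD 3 0))

/-- The list of the entries of a row. -/
def rowList (r : Row) : List ℕ := [r.1, r.2.1, r.2.2.1, r.2.2.2]

theorem rowList_injective : Function.Injective rowList := by
  rintro ⟨a, b, c, d⟩ ⟨a', b', c', d'⟩ h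
  simpa [rowList, Fin.ext_iff] using h

open Classical in
/-- The template with given quaternary symbols over the labels with numbers at most the length of
the word `l`. -/
noncomputable def templateCode (specs : List (Spec Γ R)) (l : List Γ) : TemplateCode :=
  ((3, (l.length + 1) * (k + 1)), specs.map fun s =>
    (4, s.rows.map rowList, (wordsBelow ((l.length + 1) * (k + 1)) 4).filter
      fun xs => decide (s.rel (viewOf e l xs))))

/-- Quantifying over members of the list instead of indices lets the arity reduce to a literal `4`
for the templates below. -/
theorem mem_pol_iff {t : TemplateCode} {n : ℕ} {f : (Fin n → Fin t.sizeA) → Fin t.sizeB} :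
    f ∈ Pol t.left t.right n ↔ ∀ x ∈ t.2, ∀ E : Fin x.1 → Fin n → Fin t.sizeA,
      (∀ j, (fun i => E i j) ∈ listedRel t.sizeA x.1 x.2.1) →
        f ∘ E ∈ listedRel t.sizeB x.1 x.2.2 := by
  rw [List.forall_mem_iff_get]
  rfl

theorem mem_pol_templateCode {specs : List (Spec Γ R)} {l : List Γ} {n : ℕ}
    {f : (Fin n → Fin 3) → Fin ((l.length + 1) * (k + 1))} :
    f ∈ Pol (templateCode e specs l).left (templateCode e specs l).right n ↔
      ∀ s ∈ specs, s.Holds l fun π => labelOf e (f π) := by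
  classical
  refine mem_pol_iff.trans ?_
  simp only [templateCode, List.forall_mem_map]
  refine forall₂_congr fun s _ => ?_
  have key : ∀ E : Fin 4 → Fin n → Fin 3,
      ((∀ j, (fun i => E i j) ∈ listedRel 3 4 (s.rows.map rowList)) →
        f ∘ E ∈ listedRel ((l.length + 1) * (k + 1)) 4
          ((wordsBelow ((l.length + 1) * (k + 1)) 4).filter
            fun xs => decide (s.rel (viewOf e l xs)))) ↔
      ((∀ x, (E 0 x, E 1 x, E 2 x, E 3 x) ∈ s.rows) → s.rel (view l (labelOf e (f (E 0)))
        (labelOf e (f (E 1))) (labelOf e (f (E 2))) (labelOf e (f (E 3))))) := by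
    intro E
    refine imp_congr (forall_congr' fun x => ?_) ?_
    · have : List.ofFn (fun i => ((E i x : Fin 3) : ℕ)) =
          rowList (E 0 x, E 1 x, E 2 x, E 3 x) := by
        simp [rowList, List.ofFn_succ]
      rw [listedRel, Set.mem_ofPred_eq, this, List.mem_map_of_injective rowList_injective]
    · rw [listedRel, Set.mem_ofPred_eq, List.mem_filter, mem_wordsBelow]
      simp [viewOf, List.ofFn_succ]
  constructor
  · intro h π₀ π₁ π₂ π₃
    exact (key ![π₀, π₁, π₂, π₃]).1 (h _)
  · intro h E
    exact (key E).2 (h _ _ _ _)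

/-- The polymorphism is given as a composite `g ∘ F` so that it inherits every symmetry of `F`. -/
theorem exists_mem_pol_templateCode {specs : List (Spec Γ R)} {l : List Γ} {n : ℕ}
    (F : (Fin n → Fin 3) → ℕ × R) (hF : ∀ s ∈ specs, s.Holds l F)
    (hle : ∀ π, (F π).1 ≤ l.length) :
    ∃ g : ℕ × R → Fin ((l.length + 1) * (k + 1)),
      g ∘ F ∈ Pol (templateCode e specs l).left (templateCode e specs l).right n := by
  have hpos : 0 < (l.length + 1) * (k + 1) := by positivity
  refine ⟨fun x => if h : x.1 * (k + 1) + (e x.2).val < (l.length + 1) * (k + 1) then ⟨_, h⟩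
    else ⟨0, hpos⟩, (mem_pol_templateCode e).2 ?_⟩
  have : (fun π => labelOf e (((fun x : ℕ × R =>
      if h : x.1 * (k + 1) + (e x.2).val < (l.length + 1) * (k + 1) then
        (⟨_, h⟩ : Fin ((l.length + 1) * (k + 1))) else ⟨0, hpos⟩) ∘ F) π).val) = F := by
    funext π
    have h : (F π).1 * (k + 1) + (e (F π).2).val < (l.length + 1) * (k + 1) := by
      have h1 := (e (F π).2).isLt
      have h2 := Nat.mul_le_mul_right (k + 1) (hle π)
      rw [Nat.add_mul, one_mul]
      omega
    simp only [Function.comp, dif_pos h, labelOf_code]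
  rwa [this]

theorem primrec_wordsBelow (m : ℕ) : Primrec fun b => wordsBelow b m := by
  induction m with
  | zero => exact Primrec.const _
  | succ m ih =>
    exact Primrec.list_flatMap Primrec.list_range
      (Primrec.list_map (ih.comp Primrec.fst)
        (Primrec.list_cons.comp (Primrec.snd.comp Primrec.fst) Primrec.snd).to₂).to₂

/-- Arbitrary properties are allowed in `specs` because `View Γ R` is a finite type: the unbounded
counters enter only through three comparisons and one letter of `l`. -/
theorem primrec_templateCode [Primcodable Γ] [Finite Γ] (specs : List (Spec Γ R)) :
    Primrec (templateCode e specs) := by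
  classical
  let _ : Primcodable R := Primcodable.ofEquiv (Fin (k + 1)) e
  have : Finite R := Finite.of_equiv _ e.symm
  have hlabel : Primrec (labelOf e) := by
    refine Primrec.pair (Primrec.nat_div.comp .id (.const _))
      (Primrec.of_equiv_symm.comp (Primrec.fin_val_iff.1 ?_))
    exact Primrec.nat_mod.comp .id (.const _)
  have hget : ∀ i, Primrec fun p : List Γ × List ℕ => labelOf e (p.2.getD i 0) := fun i =>
    hlabel.comp ((Primrec.list_getD 0).comp .snd (.const i))
  have hview : Primrec fun p : List Γ × List ℕ => (viewOf e p.1 p.2 : View Γ R) := by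
    have hn := fun i => Primrec.fst.comp (hget i)
    have hr := fun i => Primrec.snd.comp (hget i)
    refine Primrec.pair (.pair (hr 0) (.pair (hr 1) (.pair (hr 2) (hr 3))))
      (.pair (.pair ?_ (.pair ?_ ?_)) (Primrec.list_getElem?.comp .fst (hn 0)))
    · exact (Primrec.eq.comp (hn 0) (.const 0)).decide
    · exact (Primrec.eq.comp (hn 2) (hn 1)).decide
    · exact (Primrec.eq.comp (hn 2) (Primrec.succ.comp (hn 1))).decide
  have hb : Primrec fun l : List Γ => (l.length + 1) * (k + 1) :=
    Primrec.nat_mul.comp (Primrec.succ.comp Primrec.list_length) (.const _)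
  have hspec : ∀ s : Spec Γ R, Primrec fun l : List Γ =>
      ((4, s.rows.map rowList, (wordsBelow ((l.length + 1) * (k + 1)) 4).filter
        fun xs => decide (s.rel (viewOf e l xs))) : ℕ × List (List ℕ) × List (List ℕ)) := by
    intro s
    refine Primrec.pair (.const _) (.pair (.const _) ?_)
    have hd : Primrec fun p : List Γ × List ℕ =>
        if decide (s.rel (viewOf e p.1 p.2)) = true then some p.2 else none := by
      refine Primrec.ite (Primrec.eq.comp ?_ (.const true)) (Primrec.option_some.comp .snd)
        (.const none)
      exact (Primrec.dom_finite fun v : View Γ R => decide (s.rel v)).comp hview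
    refine (Primrec.listFilterMap ((primrec_wordsBelow 4).comp hb) hd.to₂).of_eq fun l => ?_
    rw [← List.filterMap_eq_filter]
    rfl
  refine Primrec.pair (.pair (.const 3) hb) ?_
  induction specs with
  | nil => exact .const _
  | cons s specs ih => exact Primrec.list_cons.comp (hspec s) ih

end Encoding

/-! ### An undecidable halting problem for a fixed machine on a blank tape -/

section Simulation

variable {Γ Λ : Type} [Inhabited Γ] [Inhabited Λ] (N : TM0.Machine Γ Λ) (S : Set Λ)

open Classical in
/-- The restriction of a Turing machine to a set of states. -/
noncomputable def restrictMachine (q : S) (a : Γ) : Option (S × TM0.Stmt Γ) :=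
  (N q.1 a).bind fun p => if h : p.1 ∈ S then some (⟨p.1, h⟩, p.2) else none

theorem nextConf_push {Q : Type} (M : Q → Γ → Option (Q × TM0.Stmt Γ)) (l : List Γ)
    {c : Conf Γ Q} {b : Γ} (hb : l[c.pc]? = some b) {L : List Γ}
    (hc : c.tape = (Tape.mk₁ L).nth) :
    nextConf M l c = ⟨c.pc + 1, c.state, (Tape.mk₁ (b :: L)).nth⟩ := by
  have h : Tape.mk₁ (b :: L) = ((Tape.mk₁ L).move Dir.left).write b := by
    simp only [Tape.mk₁, Tape.mk₂, Tape.move_left_mk', ← ListBlank.cons_mk, Tape.write_mk']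
    congr 1
  simp only [nextConf, hb, action, Option.isSome_some, if_true, Option.getD_some, h, hc]
  congr 1
  funext x
  rw [Tape.write_nth, Tape.move_left_nth]
  rfl

theorem conf_push {Q : Type} (q₀ : Q) (M : Q → Γ → Option (Q × TM0.Stmt Γ)) (l : List Γ) (j : ℕ)
    (hj : j ≤ l.length) :
    conf default q₀ M l j = ⟨j, some q₀, (Tape.mk₁ (l.take j).reverse).nth⟩ := by
  induction j with
  | zero =>
    simp only [conf, List.take_zero, List.reverse_nil]
    congr 1
    funext x
    rcases x with x | x
    · change default = (Tape.mk' (ListBlank.mk []) (ListBlank.mk [])).nth (x : ℤ)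
      rw [Tape.mk'_nth_nat, ListBlank.nth_mk]
      rfl
    · change default = (ListBlank.mk []).nth x
      rw [ListBlank.nth_mk]
      rfl
  | succ j ih =>
    have ih := ih (by omega)
    have hb : l[j]? = some l[j] := List.getElem?_eq_getElem (by omega)
    rw [conf, ih, nextConf_push M l hb rfl, List.take_add_one, hb]
    simp only [Option.toList_some, List.reverse_append, List.reverse_cons, List.reverse_nil,
      List.nil_append, List.cons_append]

/-- A configuration of the machine corresponds to one of its restriction. -/
def Matches (l : List Γ) (a : TM0.Cfg Γ Λ) (c : Conf Γ S) : Prop :=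
  c.pc = l.length ∧ (∃ q : S, c.state = some q ∧ q.1 = a.q) ∧ c.tape = a.Tape.nth

variable {N S}

theorem state_nextConf_eq_none {l : List Γ} {a : TM0.Cfg Γ Λ} {c : Conf Γ S} (h : Matches S l a c)
    (ha : TM0.step N a = none) : (nextConf (restrictMachine N S) l c).state = none := by
  obtain ⟨h1, ⟨q, h2, h3⟩, h4⟩ := h
  obtain ⟨q', T⟩ := a
  have hN : N q.1 (T.nth 0) = none := by
    rw [h3, Tape.nth_zero]
    exact Option.map_eq_none_iff.1 ha
  have hN' : restrictMachine N S q (T.nth 0) = none := by rw [restrictMachine, hN]; rfl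
  have hnone : l[c.pc]? = none := by rw [h1]; simp
  simp only [nextConf, hnone, h2, h4, action, hN']

theorem matches_nextConf (hS : TM0.Supports N S) {l : List Γ} {a a' : TM0.Cfg Γ Λ} {c : Conf Γ S}
    (h : Matches S l a c) (ha : TM0.step N a = some a') :
    Matches S l a' (nextConf (restrictMachine N S) l c) := by
  obtain ⟨h1, ⟨q, h2, h3⟩, h4⟩ := h
  obtain ⟨q', T⟩ := a
  obtain ⟨⟨p, s⟩, hp, rfl⟩ := Option.map_eq_some_iff.1 ha
  have hpS : p ∈ S := hS.2 hp (by rw [← show q.1 = q' from h3]; exact q.2)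
  have hN : restrictMachine N S q (T.nth 0) = some (⟨p, hpS⟩, s) := by
    simp only at h3
    rw [restrictMachine, h3, Tape.nth_zero, hp]
    simp [hpS]
  have hnone : l[c.pc]? = none := by rw [h1]; simp
  rcases s with (_ | _) | b
  · refine ⟨?_, ⟨⟨p, hpS⟩, ?_, rfl⟩, ?_⟩ <;> simp only [nextConf, hnone, h2, h4, action, hN]
    · simpa using h1
    · funext x
      rw [Tape.move_left_nth]
      split_ifs with hx
      · subst hx; rfl
      · rfl
  · refine ⟨?_, ⟨⟨p, hpS⟩, ?_, rfl⟩, ?_⟩ <;> simp only [nextConf, hnone, h2, h4, action, hN]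
    · simpa using h1
    · funext x
      rw [Tape.move_right_nth]
      split_ifs with hx
      · subst hx; rfl
      · rfl
  · refine ⟨?_, ⟨⟨p, hpS⟩, ?_, rfl⟩, ?_⟩ <;> simp only [nextConf, hnone, h2, h4, action, hN]
    · simpa using h1
    · funext x
      rw [Tape.write_nth]
      simp

/-- After `l.length` steps the pushes have put `l.reverse` on the tape; from then on the two
machines run in lockstep. -/
theorem exists_state_eq_none_iff (hS : TM0.Supports N S) (l : List Γ) :
    (∃ n, (conf default ⟨default, hS.1⟩ (restrictMachine N S) l n).state = none) ↔
      (TM0.eval N l.reverse).Dom := by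
  have hdom : (TM0.eval N l.reverse).Dom ↔
      ∃ b, StateTransition.Reaches (TM0.step N) (TM0.init l.reverse) b ∧ TM0.step N b = none := by
    rw [TM0.eval, Part.map_Dom, Part.dom_iff_mem]
    simp only [StateTransition.mem_eval]
  have hinit : Matches S l (TM0.init l.reverse)
      (conf default ⟨default, hS.1⟩ (restrictMachine N S) l l.length) := by
    rw [conf_push _ _ _ _ le_rfl, List.take_length]
    exact ⟨rfl, ⟨_, rfl, rfl⟩, rfl⟩
  rw [hdom]
  constructor
  · rintro ⟨n, hn⟩
    by_contra hcon
    push Not at hcon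
    have key : ∀ k, ∃ a, StateTransition.Reaches (TM0.step N) (TM0.init l.reverse) a ∧
        Matches S l a (conf default ⟨default, hS.1⟩ (restrictMachine N S) l (l.length + k)) := by
      intro k
      induction k with
      | zero => exact ⟨_, .refl, hinit⟩
      | succ k ih =>
        obtain ⟨a, ha, hm⟩ := ih
        obtain ⟨a', ha'⟩ := Option.ne_none_iff_exists'.1 (hcon a ha)
        exact ⟨a', ha.tail ha', matches_nextConf hS hm ha'⟩
    rcases le_total n l.length with h | h
    · rw [conf_push _ _ _ _ h] at hn
      simp at hn
    · obtain ⟨k, rfl⟩ := Nat.exists_eq_add_of_le h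
      obtain ⟨a, -, -, ⟨q, hq, -⟩, -⟩ := key k
      rw [hq] at hn
      simp at hn
  · rintro ⟨b, hb, hb'⟩
    have key : ∃ k, Matches S l b
        (conf default ⟨default, hS.1⟩ (restrictMachine N S) l (l.length + k)) := by
      clear hb'
      induction hb with
      | refl => exact ⟨0, hinit⟩
      | tail _ h ih =>
        obtain ⟨k, hk⟩ := ih
        exact ⟨k + 1, matches_nextConf hS hk h⟩
    obtain ⟨k, hk⟩ := key
    exact ⟨l.length + k + 1, state_nextConf_eq_none hk hb'⟩

end Simulation

theorem state_eq_none_mono {Γ Q : Type} (blank : Γ) (q₀ : Q) (M : Q → Γ → Option (Q × TM0.Stmt Γ))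
    (l : List Γ) {n m : ℕ} (hnm : n ≤ m) (h : (conf blank q₀ M l n).state = none) :
    (conf blank q₀ M l m).state = none := by
  induction m, hnm using Nat.le_induction with
  | base => exact h
  | succ m _ ih =>
    simp only [conf, nextConf, ih]
    cases l[(conf blank q₀ M l m).pc]? <;> rfl

/-! ### Binary inputs and a universal machine -/

theorem primrec_bits : Primrec Nat.bits := by
  have hlen : Primrec fun p : Unit × List (List Bool) => p.2.length :=
    Primrec.list_length.comp .snd
  -- `L` lists the values at all smaller arguments, so its length is the current argument.
  have hg : Primrec₂ fun (_ : Unit) (L : List (List Bool)) =>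
      if L.length = 0 then some ([] : List Bool)
      else some (decide (L.length % 2 = 1) :: L.getD (L.length / 2) []) := by
    refine Primrec.ite (Primrec.eq.comp hlen (.const 0)) (.const _)
      (Primrec.option_some.comp (Primrec.list_cons.comp ?_ ?_))
    · exact (Primrec.eq.comp (Primrec.nat_mod.comp hlen (.const 2)) (.const 1)).decide
    · exact (Primrec.list_getD []).comp .snd (Primrec.nat_div.comp hlen (.const 2))
  have h := Primrec.nat_strong_rec (fun (_ : Unit) n => Nat.bits n) hg ?_
  · exact h.comp (.const ()) .id
  · intro _ n
    simp only [List.length_map, List.length_range]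
    rcases Nat.eq_zero_or_pos n with rfl | hn
    · simp
    · rw [if_neg hn.ne']
      have hlt : n / 2 < n := Nat.div_lt_self hn one_lt_two
      have : (List.map (fun n => Nat.bits n) (List.range n)).getD (n / 2) [] = (n / 2).bits := by
        simp [List.getD, hlt]
      rw [this]
      congr 1
      rcases Nat.mod_two_eq_zero_or_one n with h0 | h0
      · conv_rhs => rw [← Nat.div_add_mod n 2, h0, add_zero, Nat.bit0_bits _ (by omega)]
        simp [h0]
      · conv_rhs => rw [← Nat.div_add_mod n 2, h0, Nat.bit1_bits]
        simp [h0]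

theorem trNat_eq_map_bits (n : ℕ) : PartrecToTM2.trNat n =
    n.bits.map fun b => if b then PartrecToTM2.Γ'.bit1 else PartrecToTM2.Γ'.bit0 := by
  have hpos : ∀ p : PosNum, PartrecToTM2.trPosNum p = (p : ℕ).bits.map
      fun b => if b then PartrecToTM2.Γ'.bit1 else PartrecToTM2.Γ'.bit0 := by
    intro p
    induction p with
    | one => simp [PartrecToTM2.trPosNum]
    | bit1 p ih =>
      rw [PosNum.cast_bit1, ← two_mul, Nat.bit1_bits, PartrecToTM2.trPosNum, ih]
      simp
    | bit0 p ih =>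
      rw [PosNum.cast_bit0, ← two_mul, Nat.bit0_bits _ p.cast_pos.ne', PartrecToTM2.trPosNum, ih]
      simp
  rw [PartrecToTM2.trNat]
  conv_rhs => rw [← Num.to_of_nat n]
  cases (n : Num) with
  | zero => simp [PartrecToTM2.trNum]
  | pos p => simpa [PartrecToTM2.trNum] using hpos p

theorem not_computablePred_eval_ofNat :
    ¬ ComputablePred fun m : ℕ =>
      (Nat.Partrec.Code.eval (Denumerable.ofNat Nat.Partrec.Code m) 0).Dom := by
  intro h
  apply ComputablePred.halting_problem 0
  obtain ⟨f, hf, h⟩ := ComputablePred.computable_iff.1 h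
  refine ComputablePred.computable_iff.2 ⟨fun c => f (Encodable.encode c),
    hf.comp Computable.encode, ?_⟩
  funext c
  have := congrFun h (Encodable.encode c)
  simpa using this

theorem exists_universal_code : ∃ c : ToPartrec.Code, ∀ m : ℕ, (c.eval [m]).Dom ↔
    (Nat.Partrec.Code.eval (Denumerable.ofNat Nat.Partrec.Code m) 0).Dom := by
  have hf : Partrec fun v : List.Vector ℕ 1 =>
      Nat.Partrec.Code.eval (Denumerable.ofNat Nat.Partrec.Code v.head) 0 :=
    Nat.Partrec.Code.eval_part.comp
      ((Computable.ofNat Nat.Partrec.Code).comp Primrec.vector_head.to_comp) (.const 0)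
  obtain ⟨c, hc⟩ := ToPartrec.Code.exists_code (Nat.Partrec'.of_part hf)
  refine ⟨c, fun m => ?_⟩
  have := hc (m ::ᵥ List.Vector.nil)
  rw [show (m ::ᵥ List.Vector.nil).1 = [m] from rfl] at this
  rw [this]
  rfl

/-- There is a Turing machine for which it is undecidable whether it halts after a given word has
been pushed on the tape. -/
theorem exists_undecidable_machine :
    ∃ (Γ Q : Type) (_ : Primcodable Γ) (_ : Finite Γ) (_ : Finite Q) (blank : Γ) (q₀ : Q)
      (M : Q → Γ → Option (Q × TM0.Stmt Γ)) (word : ℕ → List Γ), Computable word ∧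
      ¬ ComputablePred fun m => ∃ n, (conf blank q₀ M (word m) n).state = none := by
  classical
  obtain ⟨c, hc⟩ := exists_universal_code
  -- The translated machines start in the default label, so the default is chosen to be the entry
  -- point of `c`.
  let _ : Inhabited PartrecToTM2.Λ' := ⟨PartrecToTM2.trNormal c PartrecToTM2.Cont'.halt⟩
  let N₁ := TM2to1.tr (PartrecToTM2.tr)
  let N := TM1to0.tr N₁
  have hS : TM0.Supports N
      ↑(TM1to0.trStmts N₁ (TM2to1.trSupp PartrecToTM2.tr
        (PartrecToTM2.codeSupp c PartrecToTM2.Cont'.halt))) :=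
    TM1to0.tr_supports N₁ (TM2to1.tr_supports _ (PartrecToTM2.tr_supports c _))
  have hinit : PartrecToTM2.init c = fun v =>
      TM2.init PartrecToTM2.K'.main (PartrecToTM2.trList v) := by
    funext v
    simp only [PartrecToTM2.init, TM2.init]
    congr 1
    funext k
    cases k <;> rfl
  have hdom : ∀ m : ℕ,
      (TM0.eval N (TM2to1.trInit (Γ := fun _ => PartrecToTM2.Γ') PartrecToTM2.K'.main
        (PartrecToTM2.trList [m]))).Dom ↔
        (c.eval [m]).Dom := by
    intro m
    rw [TM1to0.tr_eval]
    refine (TM2to1.tr_eval_dom PartrecToTM2.tr PartrecToTM2.K'.main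
      (PartrecToTM2.trList [m])).trans ?_
    have h := PartrecToTM2.tr_eval c [m]
    rw [hinit] at h
    change (StateTransition.eval (TM2.step PartrecToTM2.tr)
      (TM2.init PartrecToTM2.K'.main (PartrecToTM2.trList [m]))).Dom ↔ _
    rw [h]
    rfl
  let Γ := TM2to1.Γ' PartrecToTM2.K' fun _ => PartrecToTM2.Γ'
  have hK : Finite PartrecToTM2.K' :=
    Finite.of_surjective (![.main, .rev, .aux, .stack] : Fin 4 → PartrecToTM2.K') fun k => by
      cases k
      exacts [⟨0, rfl⟩, ⟨1, rfl⟩, ⟨2, rfl⟩, ⟨3, rfl⟩]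
  have hfin : Finite Γ := inferInstanceAs
    (Finite (Bool × (PartrecToTM2.K' → Option PartrecToTM2.Γ')))
  obtain ⟨g, ⟨eΓ⟩⟩ := Finite.exists_equiv_fin Γ
  let iΓ : Primcodable Γ := Primcodable.ofEquiv (Fin g) eΓ
  let sym : PartrecToTM2.Γ' → Γ := fun a =>
    (false, Function.update (fun _ => none) PartrecToTM2.K'.main (some a))
  let bit : Bool → Γ := fun b =>
    sym (if b then PartrecToTM2.Γ'.bit1 else PartrecToTM2.Γ'.bit0)
  -- The flag `true` marks the bottom of the stacks. That cell comes first on the initial tape,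
  -- hence is pushed last.
  let bottom : Γ := (true, (sym PartrecToTM2.Γ'.cons).2)
  have hword : ∀ m : ℕ,
      TM2to1.trInit (Γ := fun _ => PartrecToTM2.Γ') PartrecToTM2.K'.main
        (PartrecToTM2.trList [m]) =
        (m.bits.map bit ++ [bottom]).reverse := by
    intro m
    have h : (PartrecToTM2.trList [m]).reverse = PartrecToTM2.Γ'.cons ::
        (m.bits.map fun b => if b then PartrecToTM2.Γ'.bit1 else PartrecToTM2.Γ'.bit0).reverse := by
      simp [PartrecToTM2.trList, trNat_eq_map_bits]
    change ((true, ((PartrecToTM2.trList [m]).reverse.map sym).headI.2) ::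
      ((PartrecToTM2.trList [m]).reverse.map sym).tail : List Γ) = _
    rw [h, List.map_cons, List.headI_cons, List.tail_cons, List.map_reverse, List.map_map,
      List.reverse_append]
    rfl
  refine ⟨Γ, _, iΓ, hfin, ?_, default, ⟨default, hS.1⟩, restrictMachine N _,
    fun m => m.bits.map bit ++ [bottom], ?_, ?_⟩
  · exact Finset.finite_toSet _
  · refine (Primrec.list_append.comp (Primrec.list_map primrec_bits ?_) (.const _)).to_comp
    exact ((Primrec.dom_finite bit).comp .snd).to₂
  · intro h
    apply not_computablePred_eval_ofNat
    refine h.of_eq fun m => ?_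
    rw [exists_state_eq_none_iff hS, ← hword, hdom, hc]

/-! ### The reductions -/

section Reduction

variable {Γ Q C : Type} (S : CertSpecs C) (isUnit : C → Prop) (blank : Γ) (q₀ : Q)
  (M : Q → Γ → Option (Q × TM0.Stmt Γ)) (halted : Bool)

/-- The constraints on certificates and those on cells of the space-time diagram. -/
def diagramSpecs : List (Spec Γ (C × Tile Γ Q)) :=
  S.map (fun s => ⟨s.1, fun v => s.2 (v.1.1.1, v.1.2.1.1, v.1.2.2.1.1, v.1.2.2.2.1)⟩) ++
    tileSpecs isUnit blank q₀ M halted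

variable {S isUnit blank q₀ M halted}

theorem holds_diagramSpecs_iff {l : List Γ} {n : ℕ} {F : (Fin n → Fin 3) → ℕ × (C × Tile Γ Q)} :
    (∀ s ∈ diagramSpecs S isUnit blank q₀ M halted, s.Holds l F) ↔
      CertHolds S (fun π => (F π).2.1) ∧
        ∀ s ∈ tileSpecs isUnit blank q₀ M halted, s.Holds l F := by
  simp only [diagramSpecs, List.forall_mem_append, List.forall_mem_map]
  rfl

variable {k : ℕ} (e : C × Tile Γ Q ≃ Fin (k + 1)) {l : List Γ}

/-- A homomorphism between the structures is a unary polymorphism. It exists whether or not `M`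
halts, because without certified tuples in arity one the step constraints are vacuous. -/
theorem smallTemplate_templateCode (cert : (Fin 1 → Fin 3) → C) (hcert : CertHolds S cert)
    (hunit : ∀ ε, ¬ isUnit (cert ε)) :
    SmallTemplate (templateCode e (diagramSpecs S isUnit blank q₀ M halted) l) := by
  obtain ⟨g, hg, hg'⟩ := exists_holds_tileSpecs_one isUnit blank q₀ M halted l cert hunit
  obtain ⟨f, hf⟩ := exists_mem_pol_templateCode e (fun π => ((g π).1, (cert π, (g π).2)))
    (holds_diagramSpecs_iff.2 ⟨hcert, hg'⟩) hg
  refine ⟨⟨?_, fun a : Fin 3 => f ((g fun _ => a).1, (cert fun _ => a, (g fun _ => a).2)), ?_⟩,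
    Nat.le_refl 3⟩
  · intro R
    have : ∀ x ∈ (templateCode e (diagramSpecs S isUnit blank q₀ M halted) l).2, 1 ≤ x.1 := by
      simp [templateCode]
    exact this _ (List.get_mem _ R)
  · intro R E hE
    exact hf R (fun i _ => E i) fun _ => hE

theorem state_of_mem_pol {n : ℕ} {f : (Fin n → Fin 3) → Fin ((l.length + 1) * (k + 1))}
    (hf : f ∈ Pol (templateCode e (diagramSpecs S isUnit blank q₀ M halted) l).left
      (templateCode e (diagramSpecs S isUnit blank q₀ M halted) l).right n)
    (hunit : CertHolds S (fun π => (labelOf e (f π)).2.1) →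
      ∀ i, isUnit (labelOf e (f (unitTuple i))).2.1) :
    (conf blank q₀ M l n).state = none ↔ halted = true := by
  obtain ⟨h1, h2⟩ := holds_diagramSpecs_iff.1 ((mem_pol_templateCode e).1 hf)
  exact state_of_tileSpecs isUnit blank q₀ M halted l _ h2 (hunit h1)

theorem exists_mem_pol_of_state {n : ℕ} (cert : (Fin n → Fin 3) → C) (hcert : CertHolds S cert)
    (hunit : ∀ ε, isUnit (cert ε) → cnt ε 1 = 1)
    (hstate : (conf blank q₀ M l n).state = none ↔ halted = true) :
    ∃ g : ℕ × (C × Tile Γ Q) → Fin ((l.length + 1) * (k + 1)),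
      g ∘ diagramLabel blank q₀ M l cert ∈
        Pol (templateCode e (diagramSpecs S isUnit blank q₀ M halted) l).left
          (templateCode e (diagramSpecs S isUnit blank q₀ M halted) l).right n :=
  exists_mem_pol_templateCode e _ (holds_diagramSpecs_iff.2
    ⟨hcert, holds_tileSpecs isUnit blank q₀ M halted l cert hunit hstate⟩)
    fun _ => conf_pc_le blank q₀ M l _

end Reduction

/-! ### Cyclic polymorphisms and the halting time -/

section Cyclic

variable {Γ Q : Type} {blank : Γ} {q₀ : Q} {M : Q → Γ → Option (Q × TM0.Stmt Γ)} {k : ℕ}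
  {e : CyclicCert × Tile Γ Q ≃ Fin (k + 1)} {halted : Bool} {l : List Γ}

theorem smallTemplate_cyclic : SmallTemplate
    (templateCode e (diagramSpecs cyclicSpecs (·.1 = true) blank q₀ M halted) l) :=
  smallTemplate_templateCode e cyclicCert (certHolds_cyclicCert (.inl rfl)) fun ε => by
    simp [cyclicCert]

theorem state_of_hasCyclic {n : ℕ} (hn : 2 ≤ n)
    (h : (templateCode e (diagramSpecs cyclicSpecs (·.1 = true) blank q₀ M halted) l).HasCyclic
      n) : (conf blank q₀ M l n).state = none ↔ halted = true := by
  obtain ⟨f, hf, hcyc⟩ : ∃ f : (Fin n → Fin 3) → Fin ((l.length + 1) * (k + 1)), f ∈ Pol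
    (templateCode e (diagramSpecs cyclicSpecs (·.1 = true) blank q₀ M halted) l).left
    (templateCode e (diagramSpecs cyclicSpecs (·.1 = true) blank q₀ M halted) l).right n ∧
      IsCyclic f := h
  refine state_of_mem_pol e hf fun hcert => unit_of_cyclicSpecs hn _ hcert ?_
  exact isCyclic_iff.2 fun π => by
    rw [isCyclic_iff.1 hcyc π]

theorem hasCyclic_of_state {p : ℕ} (hp : p.Prime)
    (h : (conf blank q₀ M l p).state = none ↔ halted = true) :
    (templateCode e (diagramSpecs cyclicSpecs (·.1 = true) blank q₀ M halted) l).HasCyclic p := by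
  obtain ⟨g, hg⟩ := exists_mem_pol_of_state e cyclicCert (certHolds_cyclicCert (.inr hp))
    (isUnit := (·.1 = true)) (fun ε hε => by simpa [cyclicCert, hp.two_le] using hε) h
  have hcyc : IsCyclic (n := p) (g ∘ diagramLabel blank q₀ M l cyclicCert) :=
    isCyclic_iff.2 fun π => by
      simp only [Function.comp_apply, diagramLabel, cnt_comp_equiv, cyclicCert_perm]
  exact ⟨_, hg, hcyc⟩

end Cyclic

/-! ### WNU polymorphisms and the halting time -/

section WNU

variable {Γ Q : Type} {blank : Γ} {q₀ : Q} {M : Q → Γ → Option (Q × TM0.Stmt Γ)} {k : ℕ}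
  {e : WNUCert × Tile Γ Q ≃ Fin (k + 1)} {halted : Bool} {l : List Γ}

theorem smallTemplate_wnu : SmallTemplate
    (templateCode e (diagramSpecs wnuSpecs (· = .unit) blank q₀ M halted) l) :=
  smallTemplate_templateCode e wnuCert (certHolds_wnuCert (.inl rfl)) fun ε => by
    rw [wnuCert, if_neg (by simp), if_neg (by simp)]
    split_ifs <;> simp

theorem hasWNU_iff_state {n : ℕ} (hn : 3 ≤ n) :
    (templateCode e (diagramSpecs wnuSpecs (· = .unit) blank q₀ M halted) l).HasWNU n ↔
      ((conf blank q₀ M l n).state = none ↔ halted = true) := by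
  constructor
  · intro h
    obtain ⟨f, hf, hwnu⟩ : ∃ f : (Fin n → Fin 3) → Fin ((l.length + 1) * (k + 1)), f ∈ Pol
      (templateCode e (diagramSpecs wnuSpecs (· = .unit) blank q₀ M halted) l).left
      (templateCode e (diagramSpecs wnuSpecs (· = .unit) blank q₀ M halted) l).right n ∧
        IsWNU f := h
    refine state_of_mem_pol e hf fun hcert => unit_of_wnuSpecs (by omega) _ hcert fun i j => ?_
    rw [unitTuple_of_isWNU hwnu i j]
  · intro h
    obtain ⟨g, hg⟩ := exists_mem_pol_of_state e wnuCert (certHolds_wnuCert (.inr hn))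
      (isUnit := (· = .unit)) (fun ε hε => by
        rw [wnuCert] at hε
        split_ifs at hε with h1
        exact h1.1) h
    have hwnu : IsWNU (n := n) (g ∘ diagramLabel blank q₀ M l wnuCert) := by
      intro i j
      funext a
      have h1 := congrFun (isWNU_wnuCert hn i j) a
      rw [minor_single, minor_single] at h1 ⊢
      simp only [Function.comp_apply, diagramLabel, h1]
      rw [cnt_single a 1 i j, cnt_single a 2 i j]
    exact ⟨_, hg, hwnu⟩

end WNU

/-! ### From halting times to the eight problems -/

theorem undecidable_of_reduction {α : Type*} [Primcodable α] {valid P : α → Prop} {K : ℕ → Prop}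
    (hK : ¬ ComputablePred K) {t : ℕ → α} (ht : Computable t) (hvalid : ∀ m, valid (t m))
    (hP : ∀ m, P (t m) ↔ K m) : Undecidable valid P := by
  classical
  rintro ⟨f, hf, hdec⟩
  apply hK
  refine ComputablePred.computable_iff.2 ⟨fun m => decide (K m), ?_, by simp⟩
  refine (hf.comp ht).of_eq fun m => ?_
  refine Part.eq_some_iff.2 ?_
  by_cases h : K m
  · simpa [h] using (hdec _ (hvalid m)).1 ((hP m).2 h)
  · simpa [h] using (hdec _ (hvalid m)).2 (mt (hP m).1 h)

theorem infinite_inter_iff_of_mono {I H : ℕ → Prop} (hI : ∀ m, ∃ n ≥ m, I n)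
    (hmono : ∀ m n, m ≤ n → H m → H n) : {n | I n ∧ H n}.Infinite ↔ ∃ n, H n := by
  constructor
  · intro h
    obtain ⟨n, hn⟩ := h.nonempty
    exact ⟨n, hn.2⟩
  · rintro ⟨n, hn⟩
    refine Set.infinite_of_not_bddAbove ?_
    rintro ⟨b, hb⟩
    obtain ⟨m, hm, hm'⟩ := hI (max (b + 1) n)
    have := hb (show m ∈ {n | I n ∧ H n} from ⟨hm', hmono n m (by omega) hn⟩)
    omega

/-- Four problems on templates are undecidable if a halting problem is encoded in the arities of
certain polymorphisms. -/
theorem undecidable_of_arities {H : ℕ → ℕ → Prop} (hmono : ∀ m n n', n ≤ n' → H m n → H m n')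
    (hH : ¬ ComputablePred fun m => ∃ n, H m n) (t : Bool → ℕ → TemplateCode)
    (ht : ∀ b, Computable (t b)) (hsmall : ∀ b m, SmallTemplate (t b m))
    (P : TemplateCode → ℕ → Prop) (I J : ℕ → Prop) (hIJ : ∀ n, I n → J n)
    (hI : ∀ m, ∃ n ≥ m, I n) (hsound : ∀ b m n, J n → P (t b m) n → (H m n ↔ b = true))
    (hcomplete : ∀ b m n, I n → (H m n ↔ b = true) → P (t b m) n) :
    Undecidable SmallTemplate (fun t => ∀ n, I n → P t n) ∧
    Undecidable SmallTemplate (fun t => ∃ n, J n ∧ P t n) ∧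
    Undecidable SmallTemplate (fun t => {n | I n ∧ ¬ P t n}.Finite) ∧
    Undecidable SmallTemplate (fun t => {n | I n ∧ P t n}.Infinite) := by
  -- On `I` the encoding is exact. On the larger set `J` only soundness is available; this suffices
  -- for "some arity", where a cyclic polymorphism of composite arity must also witness halting.
  have hiff : ∀ b m n, I n → (P (t b m) n ↔ (H m n ↔ b = true)) := fun b m n hn =>
    ⟨hsound b m n (hIJ n hn), hcomplete b m n hn⟩
  have hH' : ¬ ComputablePred fun m => ¬ ∃ n, H m n := fun h => hH (h.not.of_eq fun m => not_not)
  have hset : ∀ m, ({n | I n ∧ H m n}.Infinite ↔ ∃ n, H m n) := fun m =>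
    infinite_inter_iff_of_mono hI (hmono m)
  refine ⟨undecidable_of_reduction hH' (ht false) (hsmall false) fun m => ?_,
    undecidable_of_reduction hH (ht true) (hsmall true) fun m => ?_,
    undecidable_of_reduction hH' (ht false) (hsmall false) fun m => ?_,
    undecidable_of_reduction hH (ht true) (hsmall true) fun m => ?_⟩
  · constructor
    · rintro h ⟨n, hn⟩
      obtain ⟨n', hn', hI'⟩ := hI n
      have := (hiff false m n' hI').1 (h n' hI')
      simp only [Bool.false_eq_true, iff_false] at this
      exact this (hmono m n n' hn' hn)
    · intro h n hn
      refine (hiff false m n hn).2 ?_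
      simp only [Bool.false_eq_true, iff_false]
      exact fun hn' => h ⟨n, hn'⟩
  · constructor
    · rintro ⟨n, hn, h⟩
      exact ⟨n, (hsound true m n hn h).2 rfl⟩
    · rintro ⟨n, hn⟩
      obtain ⟨n', hn', hI'⟩ := hI n
      exact ⟨n', hIJ n' hI', hcomplete true m n' hI' (iff_of_true (hmono m n n' hn' hn) rfl)⟩
  · rw [← not_iff_not, not_not, ← hset]
    have : {n | I n ∧ ¬ P (t false m) n} = {n | I n ∧ H m n} := by
      ext n
      refine and_congr_right fun hn => ?_
      rw [hiff false m n hn]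
      simp
    rw [this]
    rfl
  · rw [← hset]
    have : {n | I n ∧ P (t true m) n} = {n | I n ∧ H m n} := by
      ext n
      refine and_congr_right fun hn => ?_
      rw [hiff true m n hn]
      simp
    rw [this]

instance {Γ Q : Type} [Finite Γ] [Finite Q] : Finite (Tile Γ Q) :=
  Finite.of_injective
    (fun r => (r.next, r.state, r.head, r.atHead, r.right, r.left)) fun r r' h => by
      simp only [Prod.mk.injEq] at h
      exact Tile.ext h.1 h.2.1 h.2.2.1 h.2.2.2.1 h.2.2.2.2.1 h.2.2.2.2.2

theorem exists_equiv_fin_succ (R : Type) [Finite R] [Nonempty R] :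
    ∃ k : ℕ, Nonempty (R ≃ Fin (k + 1)) := by
  obtain ⟨n, ⟨e⟩⟩ := Finite.exists_equiv_fin R
  obtain ⟨r⟩ := ‹Nonempty R›
  have := (e r).pos
  obtain ⟨k, rfl⟩ := Nat.exists_eq_succ_of_ne_zero this.ne'
  exact ⟨k, ⟨e⟩⟩

end PCSP

open PCSP in
theorem mainTheorem1 :
    -- cyclic polymorphisms: all primes, some arity, almost all primes, infinitely many primes
    Undecidable SmallTemplate (fun t => ∀ p : ℕ, p.Prime → t.HasCyclic p) ∧
    Undecidable SmallTemplate (fun t => ∃ n : ℕ, 2 ≤ n ∧ t.HasCyclic n) ∧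
    Undecidable SmallTemplate (fun t => {p : ℕ | p.Prime ∧ ¬ t.HasCyclic p}.Finite) ∧
    Undecidable SmallTemplate (fun t => {p : ℕ | p.Prime ∧ t.HasCyclic p}.Infinite) ∧
    -- WNU polymorphisms, likewise for the arities at least three
    Undecidable SmallTemplate (fun t => ∀ k : ℕ, 3 ≤ k → t.HasWNU k) ∧
    Undecidable SmallTemplate (fun t => ∃ k : ℕ, 3 ≤ k ∧ t.HasWNU k) ∧
    Undecidable SmallTemplate (fun t => {k : ℕ | 3 ≤ k ∧ ¬ t.HasWNU k}.Finite) ∧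
    Undecidable SmallTemplate (fun t => {k : ℕ | 3 ≤ k ∧ t.HasWNU k}.Infinite) := by
  obtain ⟨Γ, Q, iΓ, hΓ, hQ, blank, q₀, M, word, hword, hundec⟩ := exists_undecidable_machine
  have hne : Nonempty (Tile Γ Q) := ⟨tileAt blank q₀ M [] 0 0⟩
  have hneW : Nonempty (WNUCert × Tile Γ Q) := hne.elim fun r => ⟨(.unit, r)⟩
  obtain ⟨k, ⟨e⟩⟩ := exists_equiv_fin_succ (CyclicCert × Tile Γ Q)
  obtain ⟨k', ⟨e'⟩⟩ := exists_equiv_fin_succ (WNUCert × Tile Γ Q)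
  have hmono : ∀ m n n', n ≤ n' → (conf blank q₀ M (word m) n).state = none →
      (conf blank q₀ M (word m) n').state = none := fun m n n' h =>
    state_eq_none_mono blank q₀ M (word m) h
  obtain ⟨h1, h2, h3, h4⟩ := undecidable_of_arities hmono hundec
    (fun b m => templateCode e (diagramSpecs cyclicSpecs (·.1 = true) blank q₀ M b) (word m))
    (fun b => (primrec_templateCode e _).to_comp.comp hword) (fun _ _ => smallTemplate_cyclic)
    TemplateCode.HasCyclic Nat.Prime (2 ≤ ·) (fun _ hp => hp.two_le) Nat.exists_infinite_primes
    (fun _ _ _ => state_of_hasCyclic) (fun _ _ _ => hasCyclic_of_state)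
  obtain ⟨h5, h6, h7, h8⟩ := undecidable_of_arities hmono hundec
    (fun b m => templateCode e' (diagramSpecs wnuSpecs (· = .unit) blank q₀ M b) (word m))
    (fun b => (primrec_templateCode e' _).to_comp.comp hword) (fun _ _ => smallTemplate_wnu)
    TemplateCode.HasWNU (3 ≤ ·) (3 ≤ ·) (fun _ h => h)
    (fun m => ⟨m + 3, by omega, by omega⟩)
    (fun _ _ _ hn => (hasWNU_iff_state hn).1) (fun _ _ _ hn => (hasWNU_iff_state hn).2)
  exact ⟨h1, h2, h3, h4, h5, h6, h7, h8⟩
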